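/- Let $d\ge 1$, let $\mathcal V=\{e_1,-e_1,\dots,e_d,-e_d\}$ be the set of $\pm$ canonical basis vectors of $\mathbb R^d$, and let $|\cdot|$ be the Euclidean norm. Let $E$ be a finite set and let $(\xi_n)_{n\ge 0}$ be a Markov chain on $E$, on a probability space $(\Omega,\mathcal A,\mathbb P)$, with transition matrix $P$ and arbitrary initial law. Let $(U_n)_{n\ge 0}$ be i.i.d. random variables on the same space, uniform on $(0,1)$, and independent of $(\xi_n)_{n\ge 0}$. For all $x\in\mathbb R^d$ and $i\in E$ let $(p(x,i,v))_{v\in\mathcal V}$ be a probability on $\mathcal V$, and let $f(x,i,\cdot)$ be the inverse of its cumulative distribution function, for an arbitrary fixed order on $\mathcal V$. Assume: (A.1) there is $K<\infty$ with $|p(x,i,v)-p(y,i,v)|\le K|x-y|$ for all $x,y\in\mathbb R^d$, $i\in E$, $v\in\mathcal V$; (A.2) $p(x,i,v)>0$ for all $x\in\mathbb R^d$, $i\in E$, $v\in\mathcal V$; (A.3) $P$ is irreducible on $E$; its invariant probability measure is denoted by $\mu$. Put $\bar f(x)=\sum_{v\in\mathcal V}v\sum_{i\in E}\mu(i)\,p(x,i,v)$.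 Let $\Pi$ and $\Pi^{(m)}$ be the projections of $\mathbb R^d$ onto $[0,1]^d$ and $[0,m]^d$. Let $(x_m)_{m\ge 1}$ be a sequence in $[0,1]^d$ with $m x_m\in\mathbb Z^d$ for all $m\ge1$ and $x_m\to x$ as $m\to\infty$. Define the reflected walk by $$X^{(m)}_0=m x_m,\qquad X^{(m)}_{n+1}=(2\Pi^{(m)}-\mathrm{Id})\bigl(X^{(m)}_n+f(X^{(m)}_n/m,\xi_n,U_n)\bigr),$$ and the rescaled interpolated walk, for $t\ge 0$ and with $n=\lfloor mt\rfloor$, by $$\bar X^{(m)}_t=(2\Pi-\mathrm{Id})\bigl(m^{-1}X^{(m)}_n+(t-m^{-1}n)\,f(m^{-1}X^{(m)}_n,\xi_n,U_n)\bigr),$$ so that $\bar X^{(m)}_0=x_m$. A solution of the averaged reflected differential equation started from $x$ is a continuous $\chi:[0,\infty)\to[0,1]^d$ for which there is a continuous $k:[0,\infty)\to\mathbb R^d$ of bounded variation on bounded intervals such that, for all $t\ge0$, $$\chi_t=x+\int_0^t\bar f(\chi_s)\,ds-k_t,\qquad k_t=\int_0^t n_s\,d|k|_s,\qquad |k|_t=\int_0^t\mathbf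 1_{\{\chi_s\in\partial[0,1]^d\}}\,d|k|_s,$$ where $|k|_t$ is the total variation of $k$ on $[0,t]$, $s\mapsto n_s$ is measurable, and, for $d|k|$-almost every $s$, $n_s$ is a unit outward normal to $[0,1]^d$ at $\chi_s$: $|n_s|=1$ and, for each coordinate $\ell$, $(n_s)_\ell=0$ if $0<(\chi_s)_\ell<1$, $(n_s)_\ell\le0$ if $(\chi_s)_\ell=0$, and $(n_s)_\ell\ge0$ if $(\chi_s)_\ell=1$. Then this equation has a unique solution $(\chi^x_t)_{t\ge0}$ started from $x$, and $\bar X^{(m)}$ converges to $\chi^x$ in probability, uniformly on compact time intervals: for all $T>0$ and $\varepsilon>0$, $$\lim_{m\to\infty}\mathbb P\Bigl\{\sup_{0\le t\le T}\bigl|\bar X^{(m)}_t-\chi^x_t\bigr|\ge\varepsilon\Bigr\}=0 .$$ -/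

import Mathlib

open MeasureTheory ProbabilityTheory Filter Topology Set
open scoped ENNReal Matrix

namespace ReflectedWalk

noncomputable section

/-- `ℝ^d` with its Euclidean norm. -/
abbrev Eucl (d : ℕ) : Type := EuclideanSpace ℝ (Fin d)

/-! ### The hypercube, projection and symmetric reflection -/

/-- The hypercube `[0,1]^d`. -/
def cube (d : ℕ) : Set (Eucl d) := {x | ∀ l, x l ∈ Icc (0 : ℝ) 1}

/-- The projection of `ℝ^d` onto the hypercube `[0,r]^d` (for `r ≥ 0`): each coordinate is moved to
the nearest point of `[0,r]`. -/
def cubeProj {d : ℕ} (r : ℝ) (x : Eucl d) : Eucl d :=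
  WithLp.toLp 2 fun l => max 0 (min r (x l))

/-- The map `2 Π - Id`, where `Π` is the projection onto `[0,r]^d`. -/
def fold {d : ℕ} (r : ℝ) (x : Eucl d) : Eucl d := (2 : ℝ) • cubeProj r x - x

/-! ### The steps and the walk -/

/-- Labels of the `2 d` steps: `(l, true)` stands for `e_l` and `(l, false)` for `-e_l`. -/
abbrev StepLabel (d : ℕ) : Type := Fin d × Bool

/-- The vector `e_l` or `-e_l` with the given label. -/
def stepVec {d : ℕ} (v : StepLabel d) : Eucl d :=
  if v.2 then EuclideanSpace.single v.1 1 else - EuclideanSpace.single v.1 1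

open Classical in
/-- The inverse of the cumulative distribution function of `q`, evaluated at `u`: the first step `v`,
in the order given by the enumeration `ord` of the steps, whose cumulated weight
`∑_{w ≤ v} q w` is at least `u`. (If there is none, which does not happen when `q` is a probability
and `u ≤ 1`, the value is `0`.) -/
def invCdf {d : ℕ} (ord : Fin (2 * d) ≃ StepLabel d) (q : StepLabel d → ℝ) (u : ℝ) : Eucl d :=
  if h : (Finset.univ.filter
      fun j : Fin (2 * d) => u ≤ ∑ k ∈ Finset.Iic j, q (ord k)).Nonempty then
    stepVec (ord (Finset.min' _ h))
  else 0

/-- The reflected walk in `[0,m]^d` started from `s`, driven by a realization `ξ` of the environment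
and `U` of the uniform variables:
`X_0 = s`, `X_{n+1} = (2 Π^{(m)} - Id) (X_n + f (X_n / m, ξ_n, U_n))`. -/
def walk {d : ℕ} {E : Type*} (f : Eucl d → E → ℝ → Eucl d) (m : ℕ) (s : Eucl d)
    (ξ : ℕ → E) (U : ℕ → ℝ) : ℕ → Eucl d
  | 0 => s
  | n + 1 =>
      fold (m : ℝ) (walk f m s ξ U n + f ((m : ℝ)⁻¹ • walk f m s ξ U n) (ξ n) (U n))

/-- The rescaled and interpolated walk: with `n = ⌊m t⌋`,
`(2 Π - Id) (X_n / m + (t - n / m) f (X_n / m, ξ_n, U_n))`. -/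
def rescaledWalk {d : ℕ} {E : Type*} (f : Eucl d → E → ℝ → Eucl d) (m : ℕ) (s : Eucl d)
    (ξ : ℕ → E) (U : ℕ → ℝ) (t : ℝ) : Eucl d :=
  fold 1 ((m : ℝ)⁻¹ • walk f m s ξ U ⌊(m : ℝ) * t⌋₊ +
    (t - (⌊(m : ℝ) * t⌋₊ : ℝ) / (m : ℝ)) •
      f ((m : ℝ)⁻¹ • walk f m s ξ U ⌊(m : ℝ) * t⌋₊) (ξ ⌊(m : ℝ) * t⌋₊) (U ⌊(m : ℝ) * t⌋₊))

/-! ### The environment -/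

/-- `(ξ_n)` is a Markov chain with transition matrix `P` (and arbitrary initial law), expressed
through its finite-dimensional distributions. -/
def IsMarkovChain {Ω E : Type*} [MeasurableSpace Ω] (Pr : Measure Ω) (P : Matrix E E ℝ)
    (ξ : ℕ → Ω → E) : Prop :=
  ∀ (n : ℕ) (i : ℕ → E),
    Pr {ω | ∀ k ≤ n + 1, ξ k ω = i k} =
      Pr {ω | ∀ k ≤ n, ξ k ω = i k} * ENNReal.ofReal (P (i n) (i (n + 1)))

/-- `μ` is an invariant probability measure of the matrix `P`. -/
structure IsInvariantProb {E : Type*} [Fintype E] (P : Matrix E E ℝ) (μ : E → ℝ) : Prop where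
  nonneg : ∀ i, 0 ≤ μ i
  sum_eq_one : ∑ i, μ i = 1
  invariant : μ ᵥ* P = μ

/-- The averaged drift `f̄(x) = ∑_v v · E^μ p(x, ξ, v)`. -/
def avgDrift {d : ℕ} {E : Type*} [Fintype E] (p : Eucl d → E → StepLabel d → ℝ) (μ : E → ℝ)
    (x : Eucl d) : Eucl d :=
  ∑ v : StepLabel d, (∑ i, μ i * p x i v) • stepVec v

/-! ### The Skorohod problem in the hypercube and the reflected equation -/

/-- The set `𝒩(x)` of unit outward normals to the hypercube at `x`
(empty when `x` is in the interior). -/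
def unitNormals {d : ℕ} (x : Eucl d) : Set (Eucl d) :=
  {v | ‖v‖ = 1 ∧ ∀ l, (x l ∈ Ioo (0 : ℝ) 1 → v l = 0) ∧ (x l = 0 → v l ≤ 0) ∧
    (x l = 1 → 0 ≤ v l)}

/-- `(x, k)` solves the Skorohod problem in `[0,1]^d` for the path `w` on `[0, ∞)`:
`w = x + k`, `k_t = ∫_0^t n_s d|k|_s`, `|k|_t = ∫_0^t 1_{x_s ∈ ∂[0,1]^d} d|k|_s`, `n_s ∈ 𝒩(x_s)`.
Here `ν` is the measure `d|k|`, that is `ν [0,t]` is the total variation of `k` on `[0,t]`. -/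
structure IsSkorohodSolution {d : ℕ} (w x k : ℝ → Eucl d) : Prop where
  continuousOn_x : ContinuousOn x (Ici 0)
  continuousOn_k : ContinuousOn k (Ici 0)
  mem_cube : ∀ t, 0 ≤ t → x t ∈ cube d
  boundedVariation : ∀ t, 0 ≤ t → BoundedVariationOn k (Icc 0 t)
  decomposition : ∀ t, 0 ≤ t → w t = x t + k t
  reflection : ∃ (ν : Measure ℝ) (n : ℝ → Eucl d), Measurable n ∧
    (∀ t, 0 ≤ t → ν (Icc 0 t) = eVariationOn k (Icc 0 t)) ∧
    (∀ᵐ s ∂(ν.restrict (Ici 0)), x s ∈ frontier (cube d)) ∧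
    (∀ᵐ s ∂(ν.restrict (Ici 0)), n s ∈ unitNormals (x s)) ∧
    ∀ t, 0 ≤ t → k t = ∫ s in Icc 0 t, n s ∂ν

/-- `χ` solves on `[0, ∞)` the reflected differential equation
`χ_t = x₀ + ∫_0^t b(χ_s) ds - k_t` in `[0,1]^d`, started from `x₀`. -/
def IsReflectedSolution {d : ℕ} (b : Eucl d → Eucl d) (x₀ : Eucl d) (χ : ℝ → Eucl d) : Prop :=
  ∃ k : ℝ → Eucl d, IsSkorohodSolution (fun t => x₀ + ∫ s in (0 : ℝ)..t, b (χ s)) χ k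

/-- The distance `sup_{t ∈ [0,T]} |φ_t - ψ_t|`, with values in `[0, ∞]`. -/
def supDist {d : ℕ} (T : ℝ) (φ ψ : ℝ → Eucl d) : ℝ≥0∞ :=
  ⨆ t ∈ Icc (0 : ℝ) T, edist (φ t) (ψ t)

end

end ReflectedWalk

/-! Everything rests on one deterministic estimate. The cube is convex, so when two paths follow the
drift `b` and are pushed along outward normals, the pushes enter the derivative of their squared
distance with a favourable sign, and Gronwall's lemma leaves only the perturbation to control.
`IsRegularSolution.comparison` is the discrete form of this: it compares a perturbed scheme y with a
Lipschitz solution χ. The perturbation r enters only through the sums of the inner products of y_j -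
χ(jδ) with r_j, so cancellations in time are not lost.

Existence: projected Euler schemes converge along an ultrafilter to a Lipschitz solution whose
normality condition is kept in an integrated form that survives limits (`exists_isRegularSolution`).
Differentiating almost everywhere recovers the Skorohod formulation
(`IsRegularSolution.isReflectedSolution`). Uniqueness: the comparison is applied to the values of
any other solution on a fine grid (`IsRegularSolution.eq_of_isReflectedSolution`).

Convergence: after rescaling, the walk is such a scheme with step h = 1/m and r_j = h (f - b). Let g
be the mean step in a given environment. Then f - g is centred given the environment and the earlier
uniform variables. The Poisson equation H - PH = g - b (`exists_poisson_kernel`) splits g - b at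
time j into H(y, ξ_{j+1}) - PH(y, ξ_j), centred by the Markov property, and H(y, ξ_j) - H(y,
ξ_{j+1}), whose sums stay bounded by summation by parts since y moves by O(h) per step. The two
centred noises are bounded and pairwise orthogonal, which makes their sums o(m) in probability,
uniformly over n ≤ mT (`tendsto_measure_exists_le_abs_sum`). -/

namespace ReflectedWalk

/-! ### The hypercube and its projection -/

variable {d : ℕ}

lemma cubeProj_apply (r : ℝ) (z : Eucl d) (l : Fin d) :
    cubeProj r z l = max 0 (min r (z l)) := rfl

lemma cubeProj_mem_cube (z : Eucl d) : cubeProj 1 z ∈ cube d := fun l => by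
  rw [cubeProj_apply]
  exact ⟨le_max_left _ _, max_le zero_le_one (min_le_left _ _)⟩

lemma inner_eq_sum (u v : Eucl d) : inner ℝ u v = ∑ l, u l * v l := by
  simp [PiLp.inner_apply, mul_comm]

/-- The obtuse angle property of the projection on a convex set. It is how convexity enters for both
discrete schemes, Euler and walk. -/
lemma inner_cubeProj_nonneg (z : Eucl d) {w : Eucl d} (hw : w ∈ cube d) :
    0 ≤ inner ℝ (cubeProj 1 z - w) (z - cubeProj 1 z) := by
  rw [inner_eq_sum]
  refine Finset.sum_nonneg fun l _ => ?_
  simp only [PiLp.sub_apply, cubeProj_apply]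
  obtain ⟨h0, h1⟩ := hw l
  rcases le_total (z l) 0 with h | h
  · rw [min_eq_right (by linarith), max_eq_left h]
    nlinarith
  rcases le_total 1 (z l) with h' | h'
  · rw [min_eq_left h', max_eq_right zero_le_one]
    nlinarith
  · rw [min_eq_right h', max_eq_right h]
    simp

lemma norm_sub_cubeProj_le (z : Eucl d) {w : Eucl d} (hw : w ∈ cube d) :
    ‖z - cubeProj 1 z‖ ≤ ‖z - w‖ := by
  have h := inner_cubeProj_nonneg z hw
  have e : z - w = (z - cubeProj 1 z) + (cubeProj 1 z - w) := by abel
  have := norm_add_sq_real (z - cubeProj 1 z) (cubeProj 1 z - w)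
  rw [← e, real_inner_comm] at this
  refine le_of_sq_le_sq ?_ (norm_nonneg _)
  nlinarith [sq_nonneg ‖cubeProj 1 z - w‖]

lemma isClosed_cube : IsClosed (cube d) := by
  have : cube d = ⋂ l : Fin d, (fun z : Eucl d => z l) ⁻¹' Icc 0 1 := by
    ext z; simp [cube]
  rw [this]
  exact isClosed_iInter fun l => isClosed_Icc.preimage (by fun_prop)

lemma norm_sub_le_of_mem_cube {u w : Eucl d} (hu : u ∈ cube d) (hw : w ∈ cube d) :
    ‖u - w‖ ≤ √d := by
  rw [EuclideanSpace.norm_eq]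
  refine Real.sqrt_le_sqrt ?_
  calc ∑ l, ‖(u - w) l‖ ^ 2 ≤ ∑ _l : Fin d, (1 : ℝ) := by
        refine Finset.sum_le_sum fun l _ => ?_
        rw [PiLp.sub_apply, Real.norm_eq_abs, sq_abs]
        have := hu l; have := hw l
        simp only [mem_Icc] at *
        nlinarith
    _ = d := by simp

/-! ### The projected Euler scheme -/

section Euler

variable {b : Eucl d → Eucl d} {h L B : ℝ} {x₀ : Eucl d}

/-- The projected Euler scheme with step `h` for the reflected equation with drift `b`. -/
def euler (b : Eucl d → Eucl d) (h : ℝ) (x₀ : Eucl d) : ℕ → Eucl d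
  | 0 => x₀
  | n + 1 => cubeProj 1 (euler b h x₀ n + h • b (euler b h x₀ n))

/-- The correction made by the projection at step `n` of the Euler scheme. -/
def eulerPush (b : Eucl d → Eucl d) (h : ℝ) (x₀ : Eucl d) (n : ℕ) : Eucl d :=
  euler b h x₀ n + h • b (euler b h x₀ n) - euler b h x₀ (n + 1)

lemma euler_mem_cube (hx : x₀ ∈ cube d) (n : ℕ) : euler b h x₀ n ∈ cube d := by
  cases n with
  | zero => exact hx
  | succ n => exact cubeProj_mem_cube _

lemma norm_eulerPush_le (hh : 0 ≤ h) (hB : ∀ y ∈ cube d, ‖b y‖ ≤ B) (hx : x₀ ∈ cube d) (n : ℕ) :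
    ‖eulerPush b h x₀ n‖ ≤ h * B := by
  have := norm_sub_cubeProj_le (euler b h x₀ n + h • b (euler b h x₀ n))
    (euler_mem_cube (b := b) (h := h) hx n)
  rw [add_sub_cancel_left, norm_smul, Real.norm_of_nonneg hh] at this
  exact this.trans (mul_le_mul_of_nonneg_left (hB _ (euler_mem_cube hx n)) hh)

lemma euler_succ (n : ℕ) : euler b h x₀ (n + 1) =
    euler b h x₀ n + h • b (euler b h x₀ n) - eulerPush b h x₀ n := by
  simp [eulerPush]

lemma euler_eq_sum (n : ℕ) : euler b h x₀ n =
    x₀ + ∑ j ∈ Finset.range n, h • b (euler b h x₀ j)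
      - ∑ j ∈ Finset.range n, eulerPush b h x₀ j := by
  induction n with
  | zero => simp [euler]
  | succ n ih =>
    rw [euler_succ, Finset.sum_range_succ, Finset.sum_range_succ]
    nth_rw 1 [ih]
    abel

lemma norm_sum_Ico_le {F : Type*} [SeminormedAddCommGroup F] {f : ℕ → F} {c : ℝ} {m n : ℕ}
    (hmn : m ≤ n) (hf : ∀ j, m ≤ j → j < n → ‖f j‖ ≤ c) :
    ‖∑ j ∈ Finset.Ico m n, f j‖ ≤ (n - m : ℝ) * c := by
  refine (norm_sum_le_of_le _ fun j hj => hf j (Finset.mem_Ico.1 hj).1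
    (Finset.mem_Ico.1 hj).2).trans ?_
  simp [Nat.cast_sub hmn]

lemma norm_sum_eulerPush_le (hh : 0 ≤ h) (hB : ∀ y ∈ cube d, ‖b y‖ ≤ B) (hx : x₀ ∈ cube d)
    {m n : ℕ} (hmn : m ≤ n) :
    ‖∑ j ∈ Finset.Ico m n, eulerPush b h x₀ j‖ ≤ (n - m) * (h * B) :=
  norm_sum_Ico_le hmn fun j _ _ => norm_eulerPush_le hh hB hx j

lemma norm_sum_drift_le (hh : 0 ≤ h) (hB : ∀ y ∈ cube d, ‖b y‖ ≤ B) (hx : x₀ ∈ cube d)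
    {m n : ℕ} (hmn : m ≤ n) :
    ‖∑ j ∈ Finset.Ico m n, h • b (euler b h x₀ j)‖ ≤ (n - m) * (h * B) :=
  norm_sum_Ico_le hmn fun j _ _ => by
    rw [norm_smul, Real.norm_of_nonneg hh]
    exact mul_le_mul_of_nonneg_left (hB _ (euler_mem_cube hx j)) hh

lemma norm_euler_sub_le (hh : 0 ≤ h) (hB : ∀ y ∈ cube d, ‖b y‖ ≤ B) (hx : x₀ ∈ cube d)
    {m n : ℕ} (hmn : m ≤ n) :
    ‖euler b h x₀ n - euler b h x₀ m‖ ≤ (n - m) * (h * (2 * B)) := by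
  have e : euler b h x₀ n - euler b h x₀ m = ∑ j ∈ Finset.Ico m n, h • b (euler b h x₀ j)
      - ∑ j ∈ Finset.Ico m n, eulerPush b h x₀ j := by
    rw [Finset.sum_Ico_eq_sub _ hmn, Finset.sum_Ico_eq_sub _ hmn, euler_eq_sum n, euler_eq_sum m]
    abel
  rw [e]
  refine (norm_sub_le _ _).trans ?_
  linarith [norm_sum_drift_le hh hB hx hmn, norm_sum_eulerPush_le hh hB hx hmn]

/-- Over n - m steps the scheme moves by at most 2B h (n - m), so freezing the drift at time m costs
L times this per step. The quadratic total is what makes `b` the right derivative of the drift term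
in the limit. -/
lemma norm_sum_drift_sub_le (hh : 0 ≤ h) (hB : ∀ y ∈ cube d, ‖b y‖ ≤ B) (hx : x₀ ∈ cube d)
    (hL0 : 0 ≤ L) (hL : ∀ y z, ‖b y - b z‖ ≤ L * ‖y - z‖) (hB0 : 0 ≤ B) {m n : ℕ} (hmn : m ≤ n) :
    ‖∑ j ∈ Finset.Ico m n, h • b (euler b h x₀ j) - ((n - m : ℝ) * h) • b (euler b h x₀ m)‖ ≤
      2 * L * B * (h * (n - m)) ^ 2 := by
  have e : ((n - m : ℝ) * h) • b (euler b h x₀ m) =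
      ∑ j ∈ Finset.Ico m n, h • b (euler b h x₀ m) := by
    rw [Finset.sum_const, Nat.card_Ico, ← Nat.cast_smul_eq_nsmul ℝ, Nat.cast_sub hmn, smul_smul]
  rw [e, ← Finset.sum_sub_distrib]
  have hmn' : (m : ℝ) ≤ n := by exact_mod_cast hmn
  refine (norm_sum_Ico_le (c := h * (L * ((n - m) * (h * (2 * B))))) hmn fun j hj hjn => ?_).trans
    (le_of_eq (by ring))
  rw [← smul_sub, norm_smul, Real.norm_of_nonneg hh]
  have h1 := norm_euler_sub_le hh hB hx hj
  have h2 : (j : ℝ) ≤ n := by exact_mod_cast hjn.le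
  refine mul_le_mul_of_nonneg_left ((hL _ _).trans (mul_le_mul_of_nonneg_left (h1.trans ?_) hL0)) hh
  gcongr

/-- The push of step j is normal at the point reached after that step. Moving the base point back to
time m costs at most 2B h (n - m) times the push size hB, and there are n - m such terms. -/
lemma inner_sum_eulerPush_ge (hh : 0 ≤ h) (hB : ∀ y ∈ cube d, ‖b y‖ ≤ B) (hx : x₀ ∈ cube d)
    (hB0 : 0 ≤ B) {m n : ℕ} (hmn : m ≤ n) {w : Eucl d} (hw : w ∈ cube d) :
    -(2 * B ^ 2 * (h * (n - m)) ^ 2) ≤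
      inner ℝ (euler b h x₀ m - w) (∑ j ∈ Finset.Ico m n, eulerPush b h x₀ j) := by
  rw [inner_sum]
  have hmn' : (m : ℝ) ≤ n := by exact_mod_cast hmn
  calc -(2 * B ^ 2 * (h * (n - m)) ^ 2)
      = ∑ j ∈ Finset.Ico m n, -((n - m) * (h * (2 * B)) * (h * B)) := by
        rw [Finset.sum_const, Nat.card_Ico, nsmul_eq_mul, Nat.cast_sub hmn]; ring
    _ ≤ _ := by
        refine Finset.sum_le_sum fun j hj => ?_
        obtain ⟨hj1, hj2⟩ := Finset.mem_Ico.1 hj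
        have e : euler b h x₀ m - w =
            (euler b h x₀ (j + 1) - w) - (euler b h x₀ (j + 1) - euler b h x₀ m) := by abel
        rw [e, inner_sub_left]
        have h1 : 0 ≤ inner ℝ (euler b h x₀ (j + 1) - w) (eulerPush b h x₀ j) :=
          inner_cubeProj_nonneg _ hw
        have h2 := real_inner_le_norm (euler b h x₀ (j + 1) - euler b h x₀ m) (eulerPush b h x₀ j)
        have h3 := norm_euler_sub_le (b := b) hh hB hx (show m ≤ j + 1 by omega)
        have h4 := norm_eulerPush_le hh hB hx j
        have h5 : ((j + 1 : ℕ) : ℝ) ≤ n := by exact_mod_cast hj2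
        have h6 : ‖euler b h x₀ (j + 1) - euler b h x₀ m‖ * ‖eulerPush b h x₀ j‖ ≤
            ((n - m) * (h * (2 * B))) * (h * B) := by
          refine mul_le_mul (h3.trans ?_) h4 (norm_nonneg _) ?_
          · gcongr
          · have : (0 : ℝ) ≤ n - m := by linarith
            positivity
        linarith

end Euler

end ReflectedWalk

/-! ### Existence of a regular solution as an ultralimit of Euler schemes -/

namespace ReflectedWalk

variable {d : ℕ}

/-- A solution `χ = x₀ + ∫ b(χ) - k` of the reflected equation with `χ`, `k` Lipschitz and with
`k` pushing outwards up to a quadratic error, which is the form of the normality condition that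
passes to the limit in discretizations. -/
structure IsRegularSolution (b : Eucl d → Eucl d) (x₀ : Eucl d) (C : ℝ) (χ k : ℝ → Eucl d) :
    Prop where
  nonneg : 0 ≤ C
  mem_cube : ∀ t, χ t ∈ cube d
  k_zero : k 0 = 0
  lipschitz_x : ∀ s t, s ≤ t → ‖χ t - χ s‖ ≤ C * (t - s)
  lipschitz_k : ∀ s t, s ≤ t → ‖k t - k s‖ ≤ C * (t - s)
  decomposition : ∀ t, 0 ≤ t → χ t = x₀ + (∫ s in (0 : ℝ)..t, b (χ s)) - k t
  normal : ∀ s t, s ≤ t → ∀ w ∈ cube d, -(C * (t - s) ^ 2) ≤ inner ℝ (χ s - w) (k t - k s)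

/-- An ultrafilter gives limits at all times at once, with no extraction of subsequences. -/
lemma exists_tendsto_hyperfilter {f : ℕ → Eucl d} {R : ℝ} (hf : ∀ n, ‖f n‖ ≤ R) :
    ∃ l, Tendsto f (hyperfilter ℕ : Filter ℕ) (𝓝 l) := by
  obtain ⟨l, -, hl⟩ := (isCompact_closedBall (0 : Eucl d) R).ultrafilter_le_nhds
    ((hyperfilter ℕ).map f) (by
      rw [Ultrafilter.coe_map, le_principal_iff, Filter.mem_map]
      exact Filter.univ_mem' fun n => by simpa using hf n)
  exact ⟨l, hl⟩

lemma lipschitzWith_of_norm_sub_le {F : Type*} [SeminormedAddCommGroup F] {f : ℝ → F} {c : ℝ}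
    (hc : 0 ≤ c) (hf : ∀ s t, s ≤ t → ‖f t - f s‖ ≤ c * (t - s)) : LipschitzWith ⟨c, hc⟩ f := by
  refine LipschitzWith.of_dist_le_mul fun s t => ?_
  rw [dist_eq_norm, Real.dist_eq]
  rcases le_total s t with hst | hst
  · rw [norm_sub_rev, abs_sub_comm, abs_of_nonneg (sub_nonneg.2 hst)]; exact hf s t hst
  · rw [abs_of_nonneg (sub_nonneg.2 hst)]; exact hf t s hst

lemma floor_mul_sub_le {M : ℝ} (hM : 0 < M) {s t : ℝ} (hst : s ≤ t) :
    M⁻¹ * ((⌊t * M⌋₊ : ℝ) - ⌊s * M⌋₊) ≤ t - s + M⁻¹ := by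
  have h1 : M⁻¹ * ((⌊t * M⌋₊ : ℝ) - ⌊s * M⌋₊) ≤ M⁻¹ * ((t - s) * M + 1) := by
    refine mul_le_mul_of_nonneg_left ?_ (by positivity)
    rcases le_total 0 t with ht | ht
    · have := Nat.floor_le (mul_nonneg ht hM.le)
      have := Nat.lt_floor_add_one (s * M)
      linarith
    · rw [Nat.floor_of_nonpos (mul_nonpos_of_nonpos_of_nonneg ht hM.le),
        Nat.floor_of_nonpos (mul_nonpos_of_nonpos_of_nonneg (hst.trans ht) hM.le)]
      have : 0 ≤ (t - s) * M := mul_nonneg (sub_nonneg.2 hst) hM.le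
      simp; linarith
  refine h1.trans (le_of_eq ?_)
  field_simp

lemma le_floor_mul_sub {M : ℝ} (hM : 0 < M) {s t : ℝ} (hs : 0 ≤ s) :
    t - s - M⁻¹ ≤ M⁻¹ * ((⌊t * M⌋₊ : ℝ) - ⌊s * M⌋₊) := by
  have h1 : M⁻¹ * ((t - s) * M - 1) ≤ M⁻¹ * ((⌊t * M⌋₊ : ℝ) - ⌊s * M⌋₊) := by
    refine mul_le_mul_of_nonneg_left ?_ (by positivity)
    have := Nat.floor_le (mul_nonneg hs hM.le)
    have := Nat.lt_floor_add_one (t * M)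
    linarith
  refine le_trans (le_of_eq ?_) h1
  field_simp

/-- The quadratic error says that `I` has right derivative `g`, which is enough for the fundamental
theorem of calculus. -/
lemma integral_eq_of_norm_sub_le_sq {I g : ℝ → Eucl d} {C : ℝ} (hg : Continuous g)
    (hI : ∀ s t, 0 ≤ s → s ≤ t → ‖I t - I s - (t - s) • g s‖ ≤ C * (t - s) ^ 2)
    (hIc : ContinuousOn I (Ici 0)) (hI0 : I 0 = 0) {t : ℝ} (ht : 0 ≤ t) :
    I t = ∫ s in (0 : ℝ)..t, g s := by
  rw [intervalIntegral.integral_eq_sub_of_hasDeriv_right_of_le ht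
    (hIc.mono Icc_subset_Ici_self) (f' := g) (fun s hs => ?_) (hg.intervalIntegrable _ _), hI0,
    sub_zero]
  rw [hasDerivWithinAt_iff_isLittleO]
  refine Asymptotics.IsBigO.trans_isLittleO (g := fun u => (u - s) ^ 2) ?_ ?_
  · refine Asymptotics.IsBigO.of_bound C ?_
    filter_upwards [self_mem_nhdsWithin] with u hu
    rw [Real.norm_of_nonneg (sq_nonneg _)]
    exact hI s u hs.1.le (le_of_lt hu)
  · have h : (fun u => (u - s) ^ 2) =o[𝓝 s] fun u => (u - s) := by
      simpa using Asymptotics.isLittleO_pow_sub_sub s (m := 2) (by norm_num)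
    exact h.mono nhdsWithin_le_nhds

theorem exists_isRegularSolution {b : Eucl d → Eucl d} {L B : ℝ} (hL0 : 0 ≤ L)
    (hL : ∀ y z, ‖b y - b z‖ ≤ L * ‖y - z‖) (hB0 : 0 ≤ B) (hB : ∀ y ∈ cube d, ‖b y‖ ≤ B)
    {x₀ : Eucl d} (hx : x₀ ∈ cube d) : ∃ C χ k, IsRegularSolution b x₀ C χ k := by
  set h : ℕ → ℝ := fun m => ((m : ℝ) + 1)⁻¹ with hh
  set N : ℕ → ℝ → ℕ := fun m t => ⌊t * ((m : ℝ) + 1)⌋₊ with hN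
  have hM (m : ℕ) : (0 : ℝ) < (m : ℝ) + 1 := by positivity
  have hpos (m : ℕ) : 0 ≤ h m := (inv_pos.2 (hM m)).le
  have hNmono (m : ℕ) {s t : ℝ} (hst : s ≤ t) : N m s ≤ N m t :=
    Nat.floor_mono (mul_le_mul_of_nonneg_right hst (hM m).le)
  have hNup (m : ℕ) {s t : ℝ} (hst : s ≤ t) : h m * ((N m t : ℝ) - N m s) ≤ t - s + h m :=
    floor_mul_sub_le (hM m) hst
  have hN0 (m : ℕ) : N m 0 = 0 := by simp [hN]
  -- The natural floor vanishes on negative reals, so the scheme is frozen at `x₀` for t ≤ 0. This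
  -- is why the bounds below, and the Lipschitz bounds of `IsRegularSolution`, hold on all of ℝ.
  have hNneg (m : ℕ) {t : ℝ} (ht : t ≤ 0) : N m t = 0 := by
    have := hNmono m ht; rw [hN0] at this; omega
  have hNc (m : ℕ) {s t : ℝ} (hst : s ≤ t) : (0 : ℝ) ≤ (N m t : ℝ) - N m s :=
    sub_nonneg.2 (Nat.cast_le.2 (hNmono m hst))
  have hlim : Tendsto h (hyperfilter ℕ : Filter ℕ) (𝓝 0) := by
    have : Tendsto h atTop (𝓝 0) := by
      simpa [hh, one_div] using tendsto_one_div_add_atTop_nhds_zero_nat (𝕜 := ℝ)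
    exact this.mono_left Nat.hyperfilter_le_atTop
  set Y : ℝ → ℕ → Eucl d := fun t m => euler b (h m) x₀ (N m t)
  set K : ℝ → ℕ → Eucl d := fun t m => ∑ j ∈ Finset.range (N m t), eulerPush b (h m) x₀ j
  set I : ℝ → ℕ → Eucl d := fun t m => ∑ j ∈ Finset.range (N m t), h m • b (euler b (h m) x₀ j)
  have hKsub (m : ℕ) {s t : ℝ} (hst : s ≤ t) :
      K t m - K s m = ∑ j ∈ Finset.Ico (N m s) (N m t), eulerPush b (h m) x₀ j :=
    (Finset.sum_Ico_eq_sub _ (hNmono m hst)).symm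
  have hIsub (m : ℕ) {s t : ℝ} (hst : s ≤ t) :
      I t m - I s m = ∑ j ∈ Finset.Ico (N m s) (N m t), h m • b (euler b (h m) x₀ j) :=
    (Finset.sum_Ico_eq_sub _ (hNmono m hst)).symm
  have hY_lip (m : ℕ) {s t : ℝ} (hst : s ≤ t) : ‖Y t m - Y s m‖ ≤ 2 * B * (t - s + h m) := by
    refine (norm_euler_sub_le (hpos m) hB hx (hNmono m hst)).trans ?_
    have := mul_le_mul_of_nonneg_left (hNup m hst) (by positivity : 0 ≤ 2 * B)
    linarith
  have hK_lip (m : ℕ) {s t : ℝ} (hst : s ≤ t) : ‖K t m - K s m‖ ≤ B * (t - s + h m) := by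
    rw [hKsub m hst]
    refine (norm_sum_eulerPush_le (hpos m) hB hx (hNmono m hst)).trans ?_
    have := mul_le_mul_of_nonneg_left (hNup m hst) hB0
    linarith
  have hI_lip (m : ℕ) {s t : ℝ} (hst : s ≤ t) : ‖I t m - I s m‖ ≤ B * (t - s + h m) := by
    rw [hIsub m hst]
    refine (norm_sum_drift_le (hpos m) hB hx (hNmono m hst)).trans ?_
    have := mul_le_mul_of_nonneg_left (hNup m hst) hB0
    linarith
  have hh1 (m : ℕ) : h m ≤ 1 := inv_le_one_of_one_le₀ (by simp)
  have hbdd {f : ℝ → ℕ → Eucl d} (h0 : ∀ t m, t ≤ 0 → f t m = 0)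
      (hf : ∀ m s t, s ≤ t → ‖f t m - f s m‖ ≤ B * (t - s + h m)) (t : ℝ) (m : ℕ) :
      ‖f t m‖ ≤ B * (|t| + 1) := by
    rcases le_total t 0 with ht | ht
    · rw [h0 t m ht, norm_zero]; positivity
    · have := hf m 0 t ht
      rw [h0 0 m le_rfl, sub_zero] at this
      refine this.trans (mul_le_mul_of_nonneg_left ?_ hB0)
      rw [abs_of_nonneg ht]; linarith [hh1 m]
  have hK0 : ∀ t m, t ≤ 0 → K t m = 0 := fun t m ht => by simp [K, hNneg m ht]
  have hI0 : ∀ t m, t ≤ 0 → I t m = 0 := fun t m ht => by simp [I, hNneg m ht]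
  choose k hk using fun t => exists_tendsto_hyperfilter (hbdd hK0 (fun m s t => hK_lip m) t)
  choose J hJ using fun t => exists_tendsto_hyperfilter (hbdd hI0 (fun m s t => hI_lip m) t)
  set χ : ℝ → Eucl d := fun t => x₀ + J t - k t with hχ
  have hY (t : ℝ) : Tendsto (Y t) (hyperfilter ℕ : Filter ℕ) (𝓝 (χ t)) := by
    have : Y t = fun m => x₀ + I t m - K t m := funext fun m => euler_eq_sum _
    rw [this]
    exact (tendsto_const_nhds.add (hJ t)).sub (hk t)
  have herr (c s t : ℝ) : Tendsto (fun m => c * (t - s + h m)) (hyperfilter ℕ : Filter ℕ)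
      (𝓝 (c * (t - s))) := by
    simpa using (tendsto_const_nhds (x := t - s)).add hlim |>.const_mul c
  have hχlip (s t : ℝ) (hst : s ≤ t) : ‖χ t - χ s‖ ≤ 2 * B * (t - s) :=
    le_of_tendsto_of_tendsto' ((hY t).sub (hY s)).norm (herr _ _ _) fun m => hY_lip m hst
  have hklip (s t : ℝ) (hst : s ≤ t) : ‖k t - k s‖ ≤ B * (t - s) :=
    le_of_tendsto_of_tendsto' ((hk t).sub (hk s)).norm (herr _ _ _) fun m => hK_lip m hst
  have hJlip (s t : ℝ) (hst : s ≤ t) : ‖J t - J s‖ ≤ B * (t - s) :=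
    le_of_tendsto_of_tendsto' ((hJ t).sub (hJ s)).norm (herr _ _ _) fun m => hI_lip m hst
  have hbc : Continuous b := by
    refine (LipschitzWith.of_dist_le_mul (K := ⟨L, hL0⟩) fun s t => ?_).continuous
    rw [dist_eq_norm, dist_eq_norm]
    exact hL s t
  have hJder (s t : ℝ) (hs : 0 ≤ s) (hst : s ≤ t) :
      ‖J t - J s - (t - s) • b (χ s)‖ ≤ 2 * L * B * (t - s) ^ 2 := by
    have hr : Tendsto (fun m => 2 * L * B * (t - s + h m) ^ 2 + h m * B)
        (hyperfilter ℕ : Filter ℕ) (𝓝 (2 * L * B * (t - s) ^ 2)) := by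
      simpa using ((((tendsto_const_nhds (x := t - s)).add hlim).pow 2).const_mul
        (2 * L * B)).add (hlim.mul_const B)
    refine le_of_tendsto_of_tendsto' (((hJ t).sub (hJ s)).sub
      (((hbc.tendsto _).comp (hY s)).const_smul (t - s))).norm hr fun m => ?_
    -- Two errors: freezing the drift at time s, and replacing t - s by its value on the grid, off
    -- by at most `h m`.
    have e : I t m - I s m - (t - s) • b (Y s m) =
        (I t m - I s m - (((N m t : ℝ) - N m s) * h m) • b (Y s m)) +
          ((((N m t : ℝ) - N m s) * h m) - (t - s)) • b (Y s m) := by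
      rw [sub_smul _ (t - s)]; abel
    change ‖I t m - I s m - (t - s) • b (Y s m)‖ ≤ _
    rw [e]
    refine (norm_add_le _ _).trans (add_le_add ?_ ?_)
    · rw [hIsub m hst]
      refine (norm_sum_drift_sub_le (hpos m) hB hx hL0 hL hB0 (hNmono m hst)).trans ?_
      refine mul_le_mul_of_nonneg_left (pow_le_pow_left₀ ?_ (hNup m hst) 2) (by positivity)
      exact mul_nonneg (hpos m) (hNc m hst)
    · rw [norm_smul]
      refine mul_le_mul ?_ (hB _ (euler_mem_cube hx _)) (norm_nonneg _) (hpos m)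
      have h1 := hNup m hst
      have h2 : t - s - h m ≤ h m * ((N m t : ℝ) - N m s) := le_floor_mul_sub (hM m) hs
      rw [Real.norm_eq_abs, abs_le]
      constructor <;> linarith
  -- One constant serves for all bounds: 2B and B are the Lipschitz constants of `χ` and `k`, and
  -- 2B² is the coefficient of the normality error.
  refine ⟨2 * B + 2 * B ^ 2, χ, k, ⟨by positivity, fun t => ?_, ?_, fun s t hst => ?_,
    fun s t hst => ?_, fun t ht => ?_, fun s t hst w hw => ?_⟩⟩
  · exact isClosed_cube.mem_of_tendsto (hY t) (Eventually.of_forall fun m => euler_mem_cube hx _)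
  · exact tendsto_nhds_unique (hk 0) (by simp [funext (hK0 0 · le_rfl)])
  · exact (hχlip s t hst).trans
      (mul_le_mul_of_nonneg_right (by nlinarith [sq_nonneg B]) (sub_nonneg.2 hst))
  · exact (hklip s t hst).trans
      (mul_le_mul_of_nonneg_right (by nlinarith [sq_nonneg B]) (sub_nonneg.2 hst))
  · rw [← integral_eq_of_norm_sub_le_sq (g := fun s => b (χ s)) (hbc.comp (lipschitzWith_of_norm_sub_le (by positivity) hχlip).continuous) hJder
      (lipschitzWith_of_norm_sub_le hB0 hJlip).continuous.continuousOn
      (tendsto_nhds_unique (hJ 0) (by simp [funext (hI0 0 · le_rfl)])) ht]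
  · have hr : Tendsto (fun m => -(2 * B ^ 2 * (t - s + h m) ^ 2))
        (hyperfilter ℕ : Filter ℕ) (𝓝 (-(2 * B ^ 2 * (t - s) ^ 2))) := by
      simpa using ((((tendsto_const_nhds (x := t - s)).add hlim).pow 2).const_mul
        (2 * B ^ 2)).neg
    have hle := le_of_tendsto_of_tendsto' hr
      (((hY s).sub_const w).inner ((hk t).sub (hk s))) fun m => ?_
    · refine le_trans ?_ hle
      have : 0 ≤ B * (t - s) ^ 2 := by positivity
      nlinarith
    · rw [hKsub m hst]
      refine le_trans ?_ (inner_sum_eulerPush_ge (hpos m) hB hx hB0 (hNmono m hst) hw)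
      refine neg_le_neg (mul_le_mul_of_nonneg_left (pow_le_pow_left₀ ?_ (hNup m hst) 2)
        (by positivity))
      exact mul_nonneg (hpos m) (hNc m hst)

end ReflectedWalk

namespace ReflectedWalk

variable {d : ℕ}

/-! ### Lipschitz paths: integral and total variation of the derivative -/

section Lipschitz

open scoped NNReal

variable {f : ℝ → Eucl d} {C : ℝ≥0}

lemma LipschitzWith.intervalIntegrable_deriv {F : Type*} [NormedAddCommGroup F] [NormedSpace ℝ F]
    [CompleteSpace F] [SecondCountableTopology F] {f : ℝ → F} (hf : LipschitzWith C f) (a b : ℝ) :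
    IntervalIntegrable (deriv f) volume a b := by
  refine (intervalIntegrable_const (c := (C : ℝ))).mono_fun
    (aestronglyMeasurable_deriv f _) (Eventually.of_forall fun s => ?_)
  simpa using norm_deriv_le_of_lipschitz hf

lemma LipschitzWith.integral_deriv_eq_sub (hf : LipschitzWith C f) (a b : ℝ) :
    ∫ s in a..b, deriv f s = f b - f a := by
  ext l
  have h1 := (EuclideanSpace.proj (𝕜 := ℝ) l).intervalIntegral_comp_comm
    (LipschitzWith.intervalIntegrable_deriv hf a b)
  have hl : LipschitzWith C fun s => f s l := by
    refine LipschitzWith.of_dist_le_mul fun s t => ?_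
    refine le_trans ?_ (hf.dist_le_mul s t)
    rw [Real.dist_eq, dist_eq_norm, ← PiLp.sub_apply, ← Real.norm_eq_abs]
    exact PiLp.norm_apply_le _ l
  have h2 := (hl.lipschitzOnWith (s := uIcc a b)).absolutelyContinuousOnInterval.integral_deriv_eq_sub
  rw [PiLp.sub_apply, ← h2]
  change (EuclideanSpace.proj (𝕜 := ℝ) l) (∫ s in a..b, deriv f s) = _
  rw [← h1]
  refine intervalIntegral.integral_congr_ae ?_
  filter_upwards [hf.ae_differentiableAt_real] with s hs _
  have := ((EuclideanSpace.proj (𝕜 := ℝ) l).hasFDerivAt.comp_hasDerivAt s hs.hasDerivAt).deriv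
  exact this.symm

lemma sum_edist_le_lintegral_of_integral_eq {f g : ℝ → Eucl d}
    (hfg : ∀ a b, ∫ s in a..b, g s = f b - f a) {u : ℕ → ℝ} (hu : Monotone u) (n : ℕ) :
    ∑ i ∈ Finset.range n, edist (f (u (i + 1))) (f (u i)) ≤ ∫⁻ s in Ioc (u 0) (u n), ‖g s‖ₑ := by
  induction n with
  | zero => simp
  | succ n ih =>
    rw [Finset.sum_range_succ, ← Ioc_union_Ioc_eq_Ioc (hu (Nat.zero_le n)) (hu (Nat.le_succ n)),
      lintegral_union measurableSet_Ioc (Set.Ioc_disjoint_Ioc_of_le le_rfl)]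
    refine add_le_add ih ?_
    rw [edist_eq_enorm_sub, ← hfg, intervalIntegral.integral_of_le (hu (Nat.le_succ n))]
    exact enorm_integral_le_lintegral_enorm _

lemma eVariationOn_Icc_le_of_lipschitz (hf : LipschitzWith C f) (a b : ℝ) :
    eVariationOn f (Icc a b) ≤ ENNReal.ofReal (C * (b - a)) := by
  have h1 := (hf.lipschitzOnWith (s := univ)).comp_eVariationOn_le (g := id) (s := Icc a b)
    (mapsTo_univ _ _)
  refine h1.trans ?_
  rcases le_or_gt a b with hab | hab
  · have h2 := (monotone_id (α := ℝ)).monotoneOn (Icc a b) |>.eVariationOn_eq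
      (left_mem_Icc.2 hab) (right_mem_Icc.2 hab)
    rw [inter_self] at h2
    rw [ENNReal.ofReal_mul (NNReal.coe_nonneg C), ENNReal.ofReal_coe_nnreal, h2]
    rfl
  · simp [Icc_eq_empty hab.not_ge]

/-- For ≤, increments are integrals of the derivative. For ≥, the variation function V is itself
Lipschitz and dominates the increments of f, hence ‖f'‖ ≤ V' almost everywhere, and V' integrates to
the total variation. -/
lemma eVariationOn_eq_lintegral_deriv (hf : LipschitzWith C f) {a b : ℝ} (hab : a ≤ b) :
    eVariationOn f (Icc a b) = ∫⁻ s in Icc a b, ‖deriv f s‖ₑ := by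
  have hint := LipschitzWith.intervalIntegrable_deriv hf a b
  apply le_antisymm
  · refine iSup_le fun ⟨n, u, hu, hus⟩ => ?_
    refine (sum_edist_le_lintegral_of_integral_eq (LipschitzWith.integral_deriv_eq_sub hf) hu n).trans
      (lintegral_mono_set ?_)
    exact fun s hs => ⟨(hus 0).1.trans hs.1.le, hs.2.trans (hus n).2⟩
  · have hloc : LocallyBoundedVariationOn f univ := hf.lipschitzOnWith.locallyBoundedVariationOn
    set V : ℝ → ℝ := variationOnFromTo f univ a with hV
    have hVsub (s t : ℝ) (hst : s ≤ t) : V t - V s = (eVariationOn f (Icc s t)).toReal := by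
      rw [hV, variationOnFromTo.sub_right hloc (mem_univ _) (mem_univ _) (mem_univ _),
        variationOnFromTo.eq_of_le f univ hst, univ_inter]
    have hfin (s t : ℝ) : eVariationOn f (Icc s t) ≠ ⊤ :=
      ((eVariationOn_Icc_le_of_lipschitz hf s t).trans_lt ENNReal.ofReal_lt_top).ne
    have hV1 (s t : ℝ) (hst : s ≤ t) : ‖f t - f s‖ ≤ V t - V s := by
      rw [hVsub s t hst, ← ENNReal.ofReal_le_iff_le_toReal (hfin s t), ofReal_norm,
        ← edist_eq_enorm_sub]
      exact eVariationOn.edist_le f (right_mem_Icc.2 hst) (left_mem_Icc.2 hst)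
    have hV2 (s t : ℝ) (hst : s ≤ t) : ‖V t - V s‖ ≤ C * (t - s) := by
      rw [Real.norm_of_nonneg ((norm_nonneg _).trans (hV1 s t hst)), hVsub s t hst]
      refine ENNReal.toReal_le_of_le_ofReal ?_ (eVariationOn_Icc_le_of_lipschitz hf s t)
      exact mul_nonneg C.2 (sub_nonneg.2 hst)
    have hVlip := lipschitzWith_of_norm_sub_le C.2 hV2
    have hVint := (hVlip.lipschitzOnWith
      (s := uIcc a b)).absolutelyContinuousOnInterval.integral_deriv_eq_sub
    have hle : ∀ᵐ s, ‖deriv f s‖ ≤ deriv V s := by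
      filter_upwards [hf.ae_differentiableAt_real, hVlip.ae_differentiableAt_real] with s h1 h2
      refine le_of_tendsto_of_tendsto (hasDerivAt_iff_tendsto_slope.1 h1.hasDerivAt).norm
        (hasDerivAt_iff_tendsto_slope.1 h2.hasDerivAt) ?_
      filter_upwards [self_mem_nhdsWithin] with t ht
      rw [slope_def_module, slope_def_field, norm_smul, norm_inv, Real.norm_eq_abs]
      rcases le_total s t with hst | hst
      · rw [abs_of_nonneg (sub_nonneg.2 hst), inv_mul_eq_div]
        exact div_le_div_of_nonneg_right (hV1 s t hst) (sub_nonneg.2 hst)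
      · rw [abs_of_nonpos (sub_nonpos.2 hst), inv_mul_eq_div, norm_sub_rev, neg_sub,
          ← neg_sub (V s), ← neg_sub s t, neg_div_neg_eq]
        exact div_le_div_of_nonneg_right (hV1 t s hst) (sub_nonneg.2 hst)
    have h3 : ∫ s in a..b, ‖deriv f s‖ ≤ (eVariationOn f (Icc a b)).toReal := by
      rw [← hVsub a b hab, ← hVint]
      exact intervalIntegral.integral_mono_ae hab hint.norm
        (LipschitzWith.intervalIntegrable_deriv hVlip a b) hle
    rw [intervalIntegral.integral_of_le hab, ← integral_Icc_eq_integral_Ioc] at h3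
    have h4 : IntegrableOn (deriv f) (Icc a b) := by
      rwa [integrableOn_Icc_iff_integrableOn_Ioc, ← intervalIntegrable_iff_integrableOn_Ioc_of_le hab]
    rw [← ofReal_integral_norm_eq_lintegral_enorm h4]
    exact ENNReal.ofReal_le_of_le_toReal h3

end Lipschitz

/-! ### Regular solutions solve the reflected equation -/

/-- Testing against points w that differ from y in a single coordinate gives the sign of each
coordinate of g. -/
lemma mem_unitNormals_of_forall {y g : Eucl d} (hy : y ∈ cube d)
    (hg : ∀ w ∈ cube d, 0 ≤ inner ℝ (y - w) g) (hg0 : g ≠ 0) : ‖g‖⁻¹ • g ∈ unitNormals y := by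
  have key (l : Fin d) (c : ℝ) (hc : y l + c ∈ Icc (0 : ℝ) 1) : c * g l ≤ 0 := by
    have hw : y + c • EuclideanSpace.single l (1 : ℝ) ∈ cube d := by
      intro j
      by_cases hj : j = l
      · subst hj; simpa using hc
      · simpa [hj] using hy j
    have := hg _ hw
    rw [sub_add_cancel_left, inner_neg_left, real_inner_smul_left,
      EuclideanSpace.inner_single_left] at this
    simpa using this
  have hpos : 0 < ‖g‖⁻¹ := inv_pos.2 (norm_pos_iff.2 hg0)
  refine ⟨by rw [norm_smul, norm_inv, norm_norm, inv_mul_cancel₀ (norm_ne_zero_iff.2 hg0)],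
    fun l => ⟨fun h => ?_, fun h => ?_, fun h => ?_⟩⟩
  · have h1 := key l (1 - y l) (by simp)
    have h2 := key l (-y l) (by simp)
    have : g l = 0 := by nlinarith [h.1, h.2]
    simp [this]
  · have h1 := key l 1 (by simp [h])
    rw [PiLp.smul_apply, smul_eq_mul]
    nlinarith
  · have h1 := key l (-1) (by simp [h])
    rw [PiLp.smul_apply, smul_eq_mul]
    nlinarith

/-- At an interior point, w = y + c g is admissible for small c > 0 and gives -c ‖g‖² ≥ 0. -/
lemma mem_frontier_of_forall {y g : Eucl d} (hy : y ∈ cube d)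
    (hg : ∀ w ∈ cube d, 0 ≤ inner ℝ (y - w) g) (hg0 : g ≠ 0) : y ∈ frontier (cube d) := by
  refine ⟨subset_closure hy, fun hi => hg0 ?_⟩
  have hc : Tendsto (fun c : ℝ => y + c • g) (𝓝[>] 0) (𝓝 y) := by
    have : Continuous fun c : ℝ => y + c • g := by fun_prop
    simpa using (this.tendsto 0).mono_left nhdsWithin_le_nhds
  obtain ⟨c, hc1, hc2⟩ := ((hc.eventually (mem_interior_iff_mem_nhds.1 hi)).and
    self_mem_nhdsWithin).exists
  have := hg _ hc1
  rw [sub_add_cancel_left, inner_neg_left, real_inner_smul_left, real_inner_self_eq_norm_sq] at this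
  have hc2 : 0 < c := hc2
  by_contra h
  have : 0 < c * ‖g‖ ^ 2 := by have := norm_pos_iff.2 h; positivity
  linarith

variable {b : Eucl d → Eucl d} {x₀ : Eucl d} {C : ℝ} {χ k : ℝ → Eucl d}

/-- Dividing the integrated normality condition by t - s makes its quadratic error vanish as t
decreases to s. -/
lemma IsRegularSolution.inner_deriv_nonneg (h : IsRegularSolution b x₀ C χ k) {s : ℝ}
    (hs : DifferentiableAt ℝ k s) {w : Eucl d} (hw : w ∈ cube d) :
    0 ≤ inner ℝ (χ s - w) (deriv k s) := by
  have h1 : Tendsto (slope k s) (𝓝[>] s) (𝓝 (deriv k s)) :=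
    (hasDerivAt_iff_tendsto_slope.1 hs.hasDerivAt).mono_left
      (nhdsWithin_mono _ fun t ht => (ne_of_gt ht))
  have h2 : Tendsto (fun t => -(C * (t - s))) (𝓝[>] s) (𝓝 0) := by
    have : Continuous fun t => -(C * (t - s)) := by fun_prop
    simpa using (this.tendsto s).mono_left nhdsWithin_le_nhds
  refine le_of_tendsto_of_tendsto h2 ((tendsto_const_nhds (x := χ s - w)).inner h1) ?_
  filter_upwards [self_mem_nhdsWithin] with t ht
  have ht : s < t := ht
  rw [slope_def_module, real_inner_smul_right, inv_mul_eq_div, le_div_iff₀ (sub_pos.2 ht)]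
  linarith [h.normal s t ht.le w hw]

/-- The total variation measure is ‖k'‖ ds and the normal is k' / ‖k'‖. -/
theorem IsRegularSolution.isReflectedSolution (h : IsRegularSolution b x₀ C χ k) :
    IsReflectedSolution b x₀ χ := by
  have hk := lipschitzWith_of_norm_sub_le h.nonneg h.lipschitz_k
  have hx := lipschitzWith_of_norm_sub_le h.nonneg h.lipschitz_x
  have hmeas : Measurable (deriv k) := measurable_deriv k
  -- The zeros of k' are null for the measure with density ‖k'‖, so the value of the normalized
  -- derivative there is irrelevant.
  have hν : ∀ᵐ s ∂(volume.withDensity fun s => ‖deriv k s‖ₑ),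
      DifferentiableAt ℝ k s ∧ deriv k s ≠ 0 := by
    rw [ae_withDensity_iff hmeas.enorm]
    filter_upwards [hk.ae_differentiableAt_real] with s hs h0
    exact ⟨hs, by simpa using h0⟩
  refine ⟨k, hx.continuous.continuousOn, hk.continuous.continuousOn, fun t _ => h.mem_cube t,
    fun t _ => ?_, fun t ht => ?_, volume.withDensity fun s => ‖deriv k s‖ₑ,
    fun s => ‖deriv k s‖⁻¹ • deriv k s, by fun_prop, fun t ht => ?_, ?_, ?_, fun t ht => ?_⟩
  · exact ((eVariationOn_Icc_le_of_lipschitz hk 0 t).trans_lt ENNReal.ofReal_lt_top).ne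
  · rw [h.decomposition t ht]; abel
  · rw [withDensity_apply _ measurableSet_Icc, eVariationOn_eq_lintegral_deriv hk ht]
  · filter_upwards [ae_restrict_of_ae hν] with s hs
    exact mem_frontier_of_forall (h.mem_cube s) (fun w hw => h.inner_deriv_nonneg hs.1 hw) hs.2
  · filter_upwards [ae_restrict_of_ae hν] with s hs
    exact mem_unitNormals_of_forall (h.mem_cube s) (fun w hw => h.inner_deriv_nonneg hs.1 hw) hs.2
  · have h1 := LipschitzWith.integral_deriv_eq_sub hk 0 t
    rw [h.k_zero, sub_zero] at h1
    rw [← h1, intervalIntegral.integral_of_le ht, ← integral_Icc_eq_integral_Ioc,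
      restrict_withDensity measurableSet_Icc,
      integral_withDensity_eq_integral_toReal_smul hmeas.enorm
        (Eventually.of_forall fun s => enorm_lt_top)]
    refine integral_congr_ae (Eventually.of_forall fun s => ?_)
    simp only [toReal_enorm]
    by_cases h0 : deriv k s = 0
    · simp [h0]
    · rw [smul_smul, mul_inv_cancel₀ (norm_ne_zero_iff.2 h0), one_smul]

end ReflectedWalk

namespace ReflectedWalk

variable {d : ℕ}

/-! ### Comparison of a discrete scheme with a regular solution -/

lemma discrete_gronwall {a : ℕ → ℝ} {A c : ℝ} (hc : 0 ≤ c) {N : ℕ}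
    (h : ∀ n ≤ N, a n ≤ A + c * ∑ j ∈ Finset.range n, a j) :
    ∀ n ≤ N, a n ≤ A * (1 + c) ^ n := by
  intro n
  induction n using Nat.strong_induction_on with
  | _ n ih =>
    intro hn
    refine (h n hn).trans ?_
    have h1 : ∑ j ∈ Finset.range n, a j ≤ ∑ j ∈ Finset.range n, A * (1 + c) ^ j :=
      Finset.sum_le_sum fun j hj => ih j (Finset.mem_range.1 hj) ((Finset.mem_range.1 hj).le.trans hn)
    have h2 : c * ∑ j ∈ Finset.range n, (1 + c) ^ j = (1 + c) ^ n - 1 := by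
      have := mul_geom_sum (1 + c) n
      rwa [add_sub_cancel_left] at this
    have h3 := mul_le_mul_of_nonneg_left h1 hc
    rw [← Finset.mul_sum] at h3
    have : c * (A * ∑ j ∈ Finset.range n, (1 + c) ^ j) = A * ((1 + c) ^ n - 1) := by
      rw [← h2]; ring
    linarith

variable {b : Eucl d → Eucl d} {x₀ : Eucl d} {C L : ℝ} {χ k : ℝ → Eucl d}

lemma continuous_of_norm_sub_le (hL0 : 0 ≤ L) (hL : ∀ y z, ‖b y - b z‖ ≤ L * ‖y - z‖) :
    Continuous b := by
  refine (LipschitzWith.of_dist_le_mul (K := ⟨L, hL0⟩) fun s t => ?_).continuous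
  rw [dist_eq_norm, dist_eq_norm]
  exact hL s t

lemma IsRegularSolution.continuous (h : IsRegularSolution b x₀ C χ k) : Continuous χ :=
  (lipschitzWith_of_norm_sub_le h.nonneg h.lipschitz_x).continuous

lemma IsRegularSolution.norm_integral_sub_le (h : IsRegularSolution b x₀ C χ k) (hL0 : 0 ≤ L)
    (hL : ∀ y z, ‖b y - b z‖ ≤ L * ‖y - z‖) {s t : ℝ} (hst : s ≤ t) :
    ‖(∫ u in s..t, b (χ u)) - (t - s) • b (χ s)‖ ≤ L * C * (t - s) ^ 2 := by
  have hc : Continuous fun u => b (χ u) := (continuous_of_norm_sub_le hL0 hL).comp h.continuous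
  rw [← intervalIntegral.integral_const, ← intervalIntegral.integral_sub
    (hc.intervalIntegrable _ _) intervalIntegrable_const]
  have := intervalIntegral.norm_integral_le_of_norm_le_const (a := s) (b := t)
    (f := fun u => b (χ u) - b (χ s)) (C := L * (C * (t - s))) fun u hu => by
      rw [uIoc_of_le hst] at hu
      refine (hL _ _).trans (mul_le_mul_of_nonneg_left ((h.lipschitz_x s u hu.1.le).trans ?_) hL0)
      exact mul_le_mul_of_nonneg_left (by linarith [hu.2]) h.nonneg
  rw [abs_of_nonneg (sub_nonneg.2 hst)] at this
  linarith

/-- The error constant in the comparison of a discrete scheme with a regular solution. -/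
noncomputable def comparisonConst (d : ℕ) (L C : ℝ) : ℝ := 2 * C ^ 2 + 2 * (√d * (L * C)) + 2 * C

/-- With D = y - χ s and Δ the difference of increments, expand ‖D + Δ‖². Each push is tested
against the position of the other path, so both have a good sign up to `e` and C (t - s)². In
`comparisonConst`, 2C² comes from ‖Δ‖², the term with √d from freezing the drift along χ, and 2C
from the normality error of `k`. -/
lemma IsRegularSolution.comparison_step (h : IsRegularSolution b x₀ C χ k) (hL0 : 0 ≤ L)
    (hL : ∀ y z, ‖b y - b z‖ ≤ L * ‖y - z‖) {s t : ℝ} (hs : 0 ≤ s) (hst : s ≤ t)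
    {y y' r κ : Eucl d} {e q : ℝ} (hy : y ∈ cube d) (hy' : y' = y + (t - s) • b y + r - κ)
    (hκ : ∀ w ∈ cube d, -e ≤ inner ℝ (y - w) κ) (hq : ‖y' - y‖ ^ 2 ≤ q) :
    ‖y' - χ t‖ ^ 2 ≤ ‖y - χ s‖ ^ 2 + 2 * L * (t - s) * ‖y - χ s‖ ^ 2 +
      (2 * inner ℝ (y - χ s) r + 2 * e + 2 * q + comparisonConst d L C * (t - s) ^ 2) := by
  have hc : Continuous fun u => b (χ u) := (continuous_of_norm_sub_le hL0 hL).comp h.continuous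
  set D := y - χ s with hD
  set Δ := (y' - y) - (χ t - χ s) with hΔ
  set R := (∫ u in s..t, b (χ u)) - (t - s) • b (χ s) with hR
  have hts : 0 ≤ t - s := sub_nonneg.2 hst
  have hχ : χ t - χ s = (t - s) • b (χ s) + R - (k t - k s) := by
    calc χ t - χ s = (x₀ + (∫ u in (0 : ℝ)..t, b (χ u)) - k t)
          - (x₀ + (∫ u in (0 : ℝ)..s, b (χ u)) - k s) := by
          rw [← h.decomposition t (hs.trans hst), ← h.decomposition s hs]
      _ = (t - s) • b (χ s) + R - (k t - k s) := by
          rw [hR, ← intervalIntegral.integral_interval_sub_left (hc.intervalIntegrable 0 t)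
            (hc.intervalIntegrable 0 s)]
          abel
  have e1 : y' - χ t = D + Δ := by rw [hD, hΔ]; abel
  have e2 : Δ = (t - s) • (b y - b (χ s)) + r - κ - R + (k t - k s) := by
    rw [hΔ, hχ, hy', smul_sub]; abel
  have hDn : ‖D‖ ≤ √d := norm_sub_le_of_mem_cube hy (h.mem_cube s)
  have hΔ2 : ‖Δ‖ ^ 2 ≤ 2 * q + 2 * C ^ 2 * (t - s) ^ 2 := by
    have h1 : ‖Δ‖ ≤ ‖y' - y‖ + C * (t - s) :=
      (norm_sub_le _ _).trans (add_le_add_right (h.lipschitz_x s t hst) _)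
    have h2 : ‖Δ‖ ^ 2 ≤ (‖y' - y‖ + C * (t - s)) ^ 2 := pow_le_pow_left₀ (norm_nonneg _) h1 2
    nlinarith [sq_nonneg (‖y' - y‖ - C * (t - s))]
  have i1 : inner ℝ D (b y - b (χ s)) ≤ L * ‖D‖ ^ 2 := by
    refine (real_inner_le_norm _ _).trans ?_
    nlinarith [hL y (χ s), norm_nonneg D]
  have i2 := hκ _ (h.mem_cube s)
  have i3 : -inner ℝ D R ≤ √d * (L * C * (t - s) ^ 2) := by
    rw [← inner_neg_right]
    refine (real_inner_le_norm _ _).trans ?_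
    rw [norm_neg]
    exact mul_le_mul hDn (h.norm_integral_sub_le hL0 hL hst) (norm_nonneg _) (Real.sqrt_nonneg _)
  have i4 : inner ℝ D (k t - k s) ≤ C * (t - s) ^ 2 := by
    have := h.normal s t hst y hy
    rw [← neg_sub y (χ s), inner_neg_left] at this
    linarith
  have i5 := mul_le_mul_of_nonneg_left i1 hts
  rw [e1, norm_add_sq_real]
  have e3 : inner ℝ D Δ = (t - s) * inner ℝ D (b y - b (χ s)) + inner ℝ D r - inner ℝ D κ
      - inner ℝ D R + inner ℝ D (k t - k s) := by
    rw [e2, inner_add_right, inner_sub_right, inner_sub_right, inner_add_right,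
      real_inner_smul_right]
  rw [e3, comparisonConst]
  nlinarith

/-- The hypothesis bounds partial sums of the inner products with `r`, not of norms: this leaves
room for the averaging of `r` over time. -/
theorem IsRegularSolution.comparison (h : IsRegularSolution b x₀ C χ k) (hL0 : 0 ≤ L)
    (hL : ∀ y z, ‖b y - b z‖ ≤ L * ‖y - z‖) {δ A : ℝ} (hδ : 0 ≤ δ) {N : ℕ}
    {y r κ : ℕ → Eucl d} {e q : ℕ → ℝ} (hy : ∀ n, n < N → y n ∈ cube d)
    (hy' : ∀ n, n < N → y (n + 1) = y n + δ • b (y n) + r n - κ n)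
    (hκ : ∀ n, n < N → ∀ w ∈ cube d, -e n ≤ inner ℝ (y n - w) (κ n))
    (hq : ∀ n, n < N → ‖y (n + 1) - y n‖ ^ 2 ≤ q n)
    (hA : ∀ n ≤ N, ‖y 0 - x₀‖ ^ 2 + ∑ j ∈ Finset.range n,
      (2 * inner ℝ (y j - χ (j * δ)) (r j) + 2 * e j + 2 * q j + comparisonConst d L C * δ ^ 2) ≤ A)
    {n : ℕ} (hn : n ≤ N) : ‖y n - χ (n * δ)‖ ^ 2 ≤ A * Real.exp (2 * L * (n * δ)) := by
  set a : ℕ → ℝ := fun n => ‖y n - χ (n * δ)‖ ^ 2 with ha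
  have hχ0 : χ 0 = x₀ := by
    rw [h.decomposition 0 le_rfl, h.k_zero, intervalIntegral.integral_same]; simp
  have hsum : ∀ n ≤ N, a n ≤ (‖y 0 - x₀‖ ^ 2 + ∑ j ∈ Finset.range n,
      (2 * inner ℝ (y j - χ (j * δ)) (r j) + 2 * e j + 2 * q j + comparisonConst d L C * δ ^ 2))
      + 2 * L * δ * ∑ j ∈ Finset.range n, a j := by
    intro n
    induction n with
    | zero => intro _; simp [ha, hχ0]
    | succ n ih =>
      intro hn
      have h1 := ih (by omega)
      have hd : ((n + 1 : ℕ) : ℝ) * δ - n * δ = δ := by push_cast; ring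
      have h2 := h.comparison_step hL0 hL (s := n * δ) (t := (n + 1 : ℕ) * δ) (by positivity)
        (by linarith) (hy n hn) (by rw [hd]; exact hy' n hn) (hκ n hn) (hq n hn)
      rw [hd] at h2
      rw [Finset.sum_range_succ, Finset.sum_range_succ]
      simp only [ha] at h1 h2 ⊢
      linarith
  have hA0 : 0 ≤ A := (sq_nonneg _).trans (by simpa using hA 0 (Nat.zero_le N))
  refine (discrete_gronwall (a := a) (A := A) (c := 2 * L * δ) (by positivity)
    (fun n hn => (hsum n hn).trans (add_le_add_left (hA n hn) _)) n hn).trans ?_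
  refine mul_le_mul_of_nonneg_left ?_ hA0
  have := pow_le_pow_left₀ (by positivity) (Real.add_one_le_exp (2 * L * δ)) n
  rw [← Real.exp_nat_mul] at this
  rw [add_comm]
  refine this.trans (le_of_eq ?_)
  ring_nf

/-! ### Uniqueness for the reflected equation -/

lemma inner_nonneg_of_mem_unitNormals {y w v : Eucl d} (hy : y ∈ cube d) (hw : w ∈ cube d)
    (hv : v ∈ unitNormals y) : 0 ≤ inner ℝ (y - w) v := by
  rw [inner_eq_sum]
  refine Finset.sum_nonneg fun l _ => ?_
  obtain ⟨h1, h2, h3⟩ := hv.2 l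
  rw [PiLp.sub_apply]
  rcases (hy l).1.eq_or_lt with h0 | h0
  · have := h2 h0.symm
    nlinarith [(hw l).1]
  rcases (hy l).2.eq_or_lt with h4 | h4
  · have := h3 h4
    nlinarith [(hw l).2]
  · simp [h1 ⟨h0, h4⟩]

/-- The variation over a single point is zero, so the measure has no mass at 0 and k' 0 = 0. -/
lemma IsReflectedSolution.apply_zero {χ' : ℝ → Eucl d} (h' : IsReflectedSolution b x₀ χ') :
    χ' 0 = x₀ := by
  obtain ⟨k', hS⟩ := h'
  obtain ⟨ν, n, -, hν, -, -, hk'⟩ := hS.reflection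
  have h1 := hS.decomposition 0 le_rfl
  have h2 := hk' 0 le_rfl
  rw [Measure.restrict_eq_zero.2, integral_zero_measure] at h2
  · simpa [h2] using h1.symm
  · rw [hν 0 le_rfl, Icc_self, eVariationOn.subsingleton _ subsingleton_singleton]

/-- An arbitrary solution, sampled on a grid, is a scheme perturbed by its own oscillation. Its push
has finite variation only, so the errors e and q of a step are ε times the variation on that step,
plus a drift part for q, and the variations telescope. -/
theorem IsRegularSolution.eq_of_isReflectedSolution (h : IsRegularSolution b x₀ C χ k)
    (hL0 : 0 ≤ L) (hL : ∀ y z, ‖b y - b z‖ ≤ L * ‖y - z‖) {B : ℝ} (hB0 : 0 ≤ B)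
    (hB : ∀ y ∈ cube d, ‖b y‖ ≤ B) {χ' : ℝ → Eucl d} (h' : IsReflectedSolution b x₀ χ') {T : ℝ}
    (hT : 0 < T) : χ' T = χ T := by
  have hstart := h'.apply_zero
  obtain ⟨k', hS⟩ := h'
  obtain ⟨ν, n, hn, hν, -, hunit, hk'⟩ := hS.reflection
  have hbc := continuous_of_norm_sub_le hL0 hL
  have hfin (t : ℝ) (ht : 0 ≤ t) : ν (Icc 0 t) ≠ ⊤ := by
    rw [hν t ht]; exact hS.boundedVariation t ht
  set M : ℝ → ℝ := fun t => (ν (Icc 0 t)).toReal with hM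
  have hMsub (s t : ℝ) (hs : 0 ≤ s) (hst : s ≤ t) : (ν (Ioc s t)).toReal = M t - M s := by
    have e : Ioc s t = Icc 0 t \ Icc 0 s := by
      ext u; simp only [mem_Ioc, Set.mem_sdiff, mem_Icc, not_and, not_le]
      exact ⟨fun hu => ⟨⟨hs.trans hu.1.le, hu.2⟩, fun _ => hu.1⟩, fun hu => ⟨hu.2 hu.1.1, hu.1.2⟩⟩
    rw [e, measure_sdiff (Icc_subset_Icc_right hst) measurableSet_Icc.nullMeasurableSet (hfin s hs),
      ENNReal.toReal_sub_of_le (measure_mono (Icc_subset_Icc_right hst)) (hfin t (hs.trans hst))]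
  have hM0 : M 0 = 0 := by
    rw [hM]; simp only
    rw [hν 0 le_rfl, Icc_self, eVariationOn.subsingleton _ subsingleton_singleton]; rfl
  have hnint : ∀ t, 0 ≤ t → IntegrableOn n (Icc 0 t) ν := fun t ht => by
    have : IsFiniteMeasure (ν.restrict (Icc 0 t)) := ⟨by
      rw [Measure.restrict_apply_univ]; exact (hfin t ht).lt_top⟩
    refine Integrable.of_bound hn.aestronglyMeasurable 1 ?_
    filter_upwards [ae_restrict_of_ae_restrict_of_subset Icc_subset_Ici_self hunit] with s hs
    exact hs.1.le
  have hksub (s t : ℝ) (hs : 0 ≤ s) (hst : s ≤ t) : k' t - k' s = ∫ u in Ioc s t, n u ∂ν := by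
    rw [hk' t (hs.trans hst), hk' s hs, ← Icc_union_Ioc_eq_Icc hs hst,
      setIntegral_union (Set.disjoint_left.2 fun u hu hu' => not_lt.2 hu.2 hu'.1) measurableSet_Ioc
      (hnint s hs) ((hnint t (hs.trans hst)).mono_set fun u hu => ⟨hs.trans hu.1.le, hu.2⟩)]
    abel
  have hunitIoc (s t : ℝ) (hs : 0 ≤ s) : ∀ᵐ u ∂ν.restrict (Ioc s t), n u ∈ unitNormals (χ' u) :=
    ae_restrict_of_ae_restrict_of_subset (fun u hu => hs.trans hu.1.le) hunit
  have hbint (s t : ℝ) (hs : 0 ≤ s) (ht : 0 ≤ t) :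
      IntervalIntegrable (fun u => b (χ' u)) volume s t := by
    refine ContinuousOn.intervalIntegrable (hbc.comp_continuousOn (hS.continuousOn_x.mono ?_))
    intro u hu
    exact (le_min hs ht).trans hu.1
  have hxsub (s t : ℝ) (hs : 0 ≤ s) (hst : s ≤ t) :
      χ' t - χ' s = (∫ u in s..t, b (χ' u)) - (k' t - k' s) := by
    have ht := hs.trans hst
    have h1 := hS.decomposition t ht
    have h2 := hS.decomposition s hs
    rw [← intervalIntegral.integral_interval_sub_left (hbint 0 t le_rfl ht) (hbint 0 s le_rfl hs)]
    rw [← sub_eq_iff_eq_add] at h1 h2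
    rw [← h1, ← h2]; abel
  have huc : UniformContinuousOn χ' (Icc 0 T) :=
    isCompact_Icc.uniformContinuousOn_of_continuous (hS.continuousOn_x.mono Icc_subset_Ici_self)
  -- The terms come, in order, from r, from the variation parts of 2e + 2q, from the drift part of
  -- 2q, and from δ² ≤ εδ.
  set G : ℝ := 2 * (√d * (L * T)) + 4 * M T + 2 * (B * T) + comparisonConst d L C * T with hG
  have main : ∀ ε : ℝ, 0 < ε → ‖χ' T - χ T‖ ^ 2 ≤ ε * G * Real.exp (2 * L * T) := by
    intro ε hε
    obtain ⟨η, hη, hη'⟩ := Metric.uniformContinuousOn_iff.1 huc ε hε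
    -- The mesh is below η to control the oscillation of χ', and below ε so that δ² ≤ εδ.
    obtain ⟨N, hN⟩ := exists_nat_gt (T / min η ε)
    have hm : 0 < min η ε := lt_min hη hε
    have hN0 : (0 : ℝ) < N := (div_pos hT hm).trans hN
    set δ : ℝ := T / N with hδ
    have hδ0 : 0 < δ := div_pos hT hN0
    have hδm : δ < min η ε := by
      rw [hδ, div_lt_iff₀ hN0]; rwa [div_lt_iff₀ hm, mul_comm] at hN
    have hNδ : (N : ℝ) * δ = T := by rw [hδ]; field_simp
    have hj1 (j : ℕ) : ((j + 1 : ℕ) : ℝ) * δ = j * δ + δ := by push_cast; ring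
    have hjN (j : ℕ) (hj : j < N) : (j : ℝ) * δ + δ ≤ T := by
      rw [← hj1, ← hNδ]
      exact mul_le_mul_of_nonneg_right (by exact_mod_cast hj) hδ0.le
    have hj0 (j : ℕ) : 0 ≤ (j : ℝ) * δ := by positivity
    have hosc (j : ℕ) (hj : j < N) (u : ℝ) (hu : u ∈ Icc (j * δ) (j * δ + δ)) :
        ‖χ' u - χ' (j * δ)‖ ≤ ε := by
      rw [← dist_eq_norm]
      refine (hη' u ⟨(hj0 j).trans hu.1, hu.2.trans (hjN j hj)⟩ _
        ⟨hj0 j, by linarith [hjN j hj]⟩ ?_).le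
      rw [Real.dist_eq, abs_of_nonneg (by linarith [hu.1])]
      linarith [hu.2, min_le_left η ε]
    have hIoc (j : ℕ) (hj : j < N) : IntegrableOn n (Ioc (j * δ) (j * δ + δ)) ν :=
      (hnint T hT.le).mono_set fun u hu => ⟨(hj0 j).trans hu.1.le, hu.2.trans (hjN j hj)⟩
    have hfinIoc (j : ℕ) (hj : j < N) : ν (Ioc (j * δ) (j * δ + δ)) < ⊤ :=
      (measure_mono (t := Icc 0 T) fun u hu =>
        ⟨(hj0 j).trans hu.1.le, hu.2.trans (hjN j hj)⟩).trans_lt (hfin T hT.le).lt_top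
    have hMj (j : ℕ) : (ν (Ioc (j * δ) (j * δ + δ))).toReal = M (j * δ + δ) - M (j * δ) :=
      hMsub _ _ (hj0 j) (by linarith)
    set r : ℕ → Eucl d := fun j =>
      (∫ u in (j * δ)..(j * δ + δ), b (χ' u)) - δ • b (χ' (j * δ)) with hr
    have hrn (j : ℕ) (hj : j < N) : ‖r j‖ ≤ L * ε * δ := by
      have h1 : r j = ∫ u in (j * δ)..(j * δ + δ), (b (χ' u) - b (χ' (j * δ))) := by
        rw [intervalIntegral.integral_sub (hbint _ _ (hj0 j) (by linarith [hj0 j]))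
          intervalIntegrable_const, intervalIntegral.integral_const, add_sub_cancel_left]
      rw [h1]
      have := intervalIntegral.norm_integral_le_of_norm_le_const (a := j * δ) (b := j * δ + δ)
        (f := fun u => b (χ' u) - b (χ' (j * δ))) (C := L * ε) fun u hu => by
          rw [uIoc_of_le (by linarith)] at hu
          exact (hL _ _).trans (mul_le_mul_of_nonneg_left (hosc j hj u ⟨hu.1.le, hu.2⟩) hL0)
      rwa [add_sub_cancel_left, abs_of_pos hδ0] at this
    have hq (j : ℕ) (hj : j < N) : ‖χ' ((j + 1 : ℕ) * δ) - χ' (j * δ)‖ ^ 2 ≤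
        ε * (B * δ + (M (j * δ + δ) - M (j * δ))) := by
      rw [hj1, sq]
      refine mul_le_mul (hosc j hj _ ⟨by linarith, le_rfl⟩) ?_ (norm_nonneg _) hε.le
      rw [hxsub _ _ (hj0 j) (by linarith)]
      refine (norm_sub_le _ _).trans (add_le_add ?_ ?_)
      · have := intervalIntegral.norm_integral_le_of_norm_le_const (a := j * δ) (b := j * δ + δ)
          (f := fun u => b (χ' u)) (C := B) fun u hu => by
            rw [uIoc_of_le (by linarith)] at hu
            exact hB _ (hS.mem_cube u ((hj0 j).trans hu.1.le))
        rwa [add_sub_cancel_left, abs_of_pos hδ0] at this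
      · rw [hksub _ _ (hj0 j) (by linarith), ← hMj]
        have := norm_setIntegral_le_of_norm_le_const_ae (hfinIoc j hj) (f := n) (C := 1) (by
          filter_upwards [hunitIoc (j * δ) (j * δ + δ) (hj0 j)] with u hu
          exact hu.1.le)
        rwa [one_mul] at this
    have hκ (j : ℕ) (hj : j < N) (w : Eucl d) (hw : w ∈ cube d) :
        -(ε * (M (j * δ + δ) - M (j * δ))) ≤
          inner ℝ (χ' (j * δ) - w) (k' (j * δ + δ) - k' (j * δ)) := by
      rw [hksub _ _ (hj0 j) (by linarith), ← integral_inner (hIoc j hj), ← hMj]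
      have e1 : -(ε * (ν (Ioc (j * δ) (j * δ + δ))).toReal) =
          ∫ _u in Ioc (j * δ) (j * δ + δ), (-ε) ∂ν := by
        rw [setIntegral_const, smul_eq_mul, Measure.real]; ring
      rw [e1]
      refine integral_mono_ae (integrableOn_const (hfinIoc j hj).ne)
        ((hIoc j hj).const_inner _) ?_
      filter_upwards [hunitIoc (j * δ) (j * δ + δ) (hj0 j),
        ae_restrict_mem measurableSet_Ioc] with u hu hu2
      have h1 := inner_nonneg_of_mem_unitNormals (hS.mem_cube u ((hj0 j).trans hu2.1.le)) hw hu
      have h2 := real_inner_le_norm (χ' u - χ' (j * δ)) (n u)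
      rw [hu.1, mul_one] at h2
      have h3 := hosc j hj u ⟨hu2.1.le, hu2.2⟩
      -- The vector n u is normal at χ' u, not at the left end of the step; the change of base point
      -- costs at most ε.
      have e2 : χ' (j * δ) - w = (χ' u - w) - (χ' u - χ' (j * δ)) := by abel
      rw [e2, inner_sub_left]
      linarith
    have hmono (i j : ℕ) (hij : i ≤ j) (hj : j ≤ N) : M (i * δ) ≤ M (j * δ) := by
      refine ENNReal.toReal_mono (hfin _ (hj0 j)) (measure_mono (Icc_subset_Icc_right ?_))
      exact mul_le_mul_of_nonneg_right (by exact_mod_cast hij) hδ0.le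
    have hcomp := h.comparison hL0 hL hδ0.le (N := N) (y := fun j => χ' (j * δ)) (r := r)
      (κ := fun j => k' (j * δ + δ) - k' (j * δ))
      (e := fun j => ε * (M (j * δ + δ) - M (j * δ)))
      (q := fun j => ε * (B * δ + (M (j * δ + δ) - M (j * δ)))) (A := ε * G)
      (fun j _ => hS.mem_cube _ (hj0 j))
      (fun j hj => by
        have := hxsub (j * δ) (j * δ + δ) (hj0 j) (by linarith)
        simp only [hr]
        rw [hj1, ← sub_eq_zero]
        rw [← sub_eq_zero] at this
        rw [← this]; abel) hκ hq ?_ le_rfl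
    · simpa only [hNδ] using hcomp
    · intro m hm
      simp only [Nat.cast_zero, zero_mul, hstart, sub_self, norm_zero]
      have hMC : 0 ≤ comparisonConst d L C := by
        have := h.nonneg
        unfold comparisonConst; positivity
      calc _ ≤ 0 ^ 2 + ∑ j ∈ Finset.range m, ((2 * (√d * (L * ε * δ)) + 2 * ε * (B * δ)
              + comparisonConst d L C * ε * δ)
              + 4 * ε * (M ((j + 1 : ℕ) * δ) - M (j * δ))) := by
            refine add_le_add_right (Finset.sum_le_sum fun j hj => ?_) _
            have hjlt : j < N := (Finset.mem_range.1 hj).trans_le hm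
            have i1 : inner ℝ (χ' (j * δ) - χ (j * δ)) (r j) ≤ √d * (L * ε * δ) :=
              (real_inner_le_norm _ _).trans (mul_le_mul
                (norm_sub_le_of_mem_cube (hS.mem_cube _ (hj0 j)) (h.mem_cube _)) (hrn j hjlt)
                (norm_nonneg _) (Real.sqrt_nonneg _))
            have i2 : comparisonConst d L C * δ ^ 2 ≤ comparisonConst d L C * ε * δ := by
              rw [sq, ← mul_assoc]
              refine mul_le_mul_of_nonneg_right (mul_le_mul_of_nonneg_left ?_ hMC) hδ0.le
              exact hδm.le.trans (min_le_right _ _)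
            rw [hj1]
            linarith
        _ = (m * δ) * (2 * (√d * (L * ε)) + 2 * ε * B + comparisonConst d L C * ε)
              + 4 * ε * M (m * δ) := by
            rw [Finset.sum_add_distrib, ← Finset.mul_sum,
              Finset.sum_range_sub fun j : ℕ => M (j * δ)]
            simp [hM0]; ring
        _ ≤ T * (2 * (√d * (L * ε)) + 2 * ε * B + comparisonConst d L C * ε) + 4 * ε * M T := by
            have h1 := hmono m N hm le_rfl
            rw [hNδ] at h1
            have h2 : m * δ ≤ T := by
              rw [← hNδ]; exact mul_le_mul_of_nonneg_right (by exact_mod_cast hm) hδ0.le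
            gcongr
        _ = ε * G := by rw [hG]; ring
  have hzero : ‖χ' T - χ T‖ ^ 2 ≤ 0 := by
    have ht : Tendsto (fun ε : ℝ => ε * G * Real.exp (2 * L * T)) (𝓝[>] 0) (𝓝 0) := by
      have : Continuous fun ε : ℝ => ε * G * Real.exp (2 * L * T) := by fun_prop
      simpa using (this.tendsto 0).mono_left nhdsWithin_le_nhds
    exact ge_of_tendsto ht (by filter_upwards [self_mem_nhdsWithin] with ε hε using main ε hε)
  have : ‖χ' T - χ T‖ = 0 := by nlinarith [norm_nonneg (χ' T - χ T)]
  exact sub_eq_zero.1 (norm_eq_zero.1 this)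

end ReflectedWalk

namespace ReflectedWalk

variable {d : ℕ}

/-! ### The inverse of the cumulative distribution function -/

lemma norm_stepVec (v : StepLabel d) : ‖stepVec v‖ = 1 := by
  unfold stepVec
  split_ifs <;> simp

/-- The cumulated weight of the steps up to the `j`-th one. -/
def cumWeight (ord : Fin (2 * d) ≃ StepLabel d) (q : StepLabel d → ℝ) (j : Fin (2 * d)) : ℝ :=
  ∑ k ∈ Finset.Iic j, q (ord k)

-- As a finite sum of indicators, the inverse distribution function can be measured and integrated
-- term by term.
open Classical in
lemma invCdf_eq_sum (ord : Fin (2 * d) ≃ StepLabel d) (q : StepLabel d → ℝ) (u : ℝ) :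
    invCdf ord q u = ∑ j, if u ≤ cumWeight ord q j ∧ ∀ k < j, cumWeight ord q k < u
      then stepVec (ord j) else 0 := by
  unfold invCdf
  split_ifs with h
  · set j₀ := Finset.min' _ h with hj₀
    have hmem := Finset.min'_mem _ h
    rw [← hj₀, Finset.mem_filter] at hmem
    have hmin (k : Fin (2 * d)) (hk : u ≤ cumWeight ord q k) : j₀ ≤ k :=
        Finset.min'_le _ k (Finset.mem_filter.2 ⟨Finset.mem_univ k, hk⟩)
    rw [Finset.sum_eq_single j₀, if_pos]
    · exact ⟨hmem.2, fun k hk => not_le.1 fun hle => (hmin k hle).not_gt hk⟩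
    · intro j _ hj
      refine if_neg fun hc => ?_
      exact (hc.2 j₀ (lt_of_le_of_ne (hmin j hc.1) hj.symm)).not_ge hmem.2
    · simp
  · refine (Finset.sum_eq_zero fun j _ => if_neg fun hc => h ⟨j, ?_⟩).symm
    exact Finset.mem_filter.2 ⟨Finset.mem_univ _, hc.1⟩

lemma norm_invCdf_le (ord : Fin (2 * d) ≃ StepLabel d) (q : StepLabel d → ℝ) (u : ℝ) :
    ‖invCdf ord q u‖ ≤ 1 := by
  unfold invCdf
  split_ifs
  · exact (norm_stepVec _).le
  · simp

lemma measurable_invCdf {α : Type*} [MeasurableSpace α] (ord : Fin (2 * d) ≃ StepLabel d)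
    {q : α → StepLabel d → ℝ} {u : α → ℝ} (hq : ∀ v, Measurable fun a => q a v)
    (hu : Measurable u) : Measurable fun a => invCdf ord (q a) (u a) := by
  classical
  have hc (j : Fin (2 * d)) : Measurable fun a => cumWeight ord (q a) j :=
    Finset.measurable_sum _ fun k _ => hq _
  simp_rw [invCdf_eq_sum]
  refine Finset.measurable_sum _ fun j _ => Measurable.ite ?_ measurable_const measurable_const
  refine (measurableSet_le hu (hc j)).inter ?_
  have e : {a | ∀ k < j, cumWeight ord (q a) k < u a} =
      ⋂ k, ⋂ (_ : k < j), {a | cumWeight ord (q a) k < u a} := by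
    ext; simp
  change MeasurableSet {a | ∀ k < j, cumWeight ord (q a) k < u a}
  rw [e]
  exact MeasurableSet.iInter fun k => MeasurableSet.iInter fun _ => measurableSet_lt (hc k) hu

/-- The step `ord j` is selected when u lies between two consecutive cumulated weights, an interval
of length `q (ord j)`. -/
lemma integral_invCdf (ord : Fin (2 * d) ≃ StepLabel d) {q : StepLabel d → ℝ}
    (hq : ∀ v, 0 ≤ q v) (hq1 : ∑ v, q v = 1) :
    ∫ u in Ioo (0 : ℝ) 1, invCdf ord q u = ∑ v, q v • stepVec v := by
  classical
  -- Positivity of u matters for the first index: there the left side is vacuous and the right side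
  -- reads 0 < u.
  have hlt (j : Fin (2 * d)) (u : ℝ) (hu : 0 < u) :
      (∀ k < j, cumWeight ord q k < u) ↔ ∑ k ∈ Finset.Iio j, q (ord k) < u := by
    constructor
    · intro h
      rcases Nat.eq_zero_or_pos j.val with h0 | h0
      · have : Finset.Iio j = ∅ := by
          ext k; simp [Fin.lt_def, h0]
        simpa [this] using hu
      · have hk : (⟨j.val - 1, by omega⟩ : Fin (2 * d)) < j := by rw [Fin.lt_def]; simp; omega
        have := h _ hk
        have e : Finset.Iic (⟨j.val - 1, by omega⟩ : Fin (2 * d)) = Finset.Iio j := by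
          ext k; simp only [Finset.mem_Iic, Finset.mem_Iio, Fin.le_def, Fin.lt_def]; omega
        rwa [cumWeight, e] at this
    · intro h k hk
      refine lt_of_le_of_lt (Finset.sum_le_sum_of_subset_of_nonneg ?_ fun _ _ _ => hq _) h
      intro l hl
      rw [Finset.mem_Iic] at hl
      exact Finset.mem_Iio.2 (hl.trans_lt hk)
  have hS (j : Fin (2 * d)) :
      cumWeight ord q j = ∑ k ∈ Finset.Iio j, q (ord k) + q (ord j) := by
    have : Finset.Iic j = insert j (Finset.Iio j) := by
      ext k; simp [le_iff_eq_or_lt]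
    rw [cumWeight, this, Finset.sum_insert (by simp), add_comm]
  have hS0 (j : Fin (2 * d)) : 0 ≤ ∑ k ∈ Finset.Iio j, q (ord k) :=
    Finset.sum_nonneg fun k _ => hq _
  have hS1 (j : Fin (2 * d)) : cumWeight ord q j ≤ 1 := by
    rw [← hq1, ← Equiv.sum_comp ord]
    exact Finset.sum_le_sum_of_subset_of_nonneg (Finset.subset_univ _) fun _ _ _ => hq _
  have e1 : EqOn (invCdf ord q) (fun u => ∑ j, (Ioc (∑ k ∈ Finset.Iio j, q (ord k))
      (cumWeight ord q j)).indicator (fun _ => stepVec (ord j)) u) (Ioo 0 1) := fun u hu => by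
    simp only [invCdf_eq_sum, indicator_apply, mem_Ioc, hlt _ u hu.1, and_comm]
  rw [setIntegral_congr_fun measurableSet_Ioo e1, ← integral_Ioc_eq_integral_Ioo,
    integral_finsetSum _ fun j _ => (integrable_const _).indicator measurableSet_Ioc,
    ← Equiv.sum_comp ord]
  refine Finset.sum_congr rfl fun j _ => ?_
  rw [setIntegral_indicator measurableSet_Ioc, setIntegral_const, Ioc_inter_Ioc,
    sup_eq_right.2 (hS0 j), inf_eq_right.2 (hS1 j), Measure.real, Real.volume_Ioc, hS,
    add_sub_cancel_left, ENNReal.toReal_ofReal (hq _)]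

/-! ### The rescaled walk as a perturbed scheme -/

lemma fold_one_eq (z : Eucl d) : fold 1 z = z - (2 : ℝ) • (z - cubeProj 1 z) := by
  rw [fold, smul_sub, two_smul ℝ z]; abel

lemma norm_fold_sub_le {y z : Eucl d} (hy : y ∈ cube d) : ‖fold 1 z - y‖ ≤ 3 * ‖z - y‖ := by
  have e : fold 1 z - y = (z - y) - (2 : ℝ) • (z - cubeProj 1 z) := by rw [fold_one_eq]; abel
  rw [e]
  refine (norm_sub_le _ _).trans ?_
  rw [norm_smul, Real.norm_two]
  linarith [norm_sub_cubeProj_le z hy]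

/-- One reflection suffices because the point is outside by at most the side of the cube. -/
lemma fold_mem_cube {y z : Eucl d} (hy : y ∈ cube d) (hz : ‖z - y‖ ≤ 1) : fold 1 z ∈ cube d := by
  intro l
  have h1 := (PiLp.norm_apply_le (z - y) l).trans hz
  rw [PiLp.sub_apply, Real.norm_eq_abs, abs_le] at h1
  have h2 := hy l
  have e : fold 1 z l = 2 * max 0 (min 1 (z l)) - z l := by
    simp [fold, cubeProj_apply]
  rw [e]
  rcases le_total (z l) 0 with h | h
  · rw [min_eq_right (by linarith), max_eq_left h]
    constructor <;> linarith [h2.1]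
  rcases le_total 1 (z l) with h' | h'
  · rw [min_eq_left h', max_eq_right zero_le_one]
    constructor <;> linarith [h2.2]
  · rw [min_eq_right h', max_eq_right h]
    constructor <;> linarith

lemma fold_smul {r : ℝ} (hr : 0 ≤ r) (z : Eucl d) : fold r (r • z) = r • fold 1 z := by
  ext l
  have : max 0 (min r (r * z l)) = r * max 0 (min 1 (z l)) := by
    rw [mul_max_of_nonneg _ _ hr, mul_min_of_nonneg _ _ hr, mul_zero, mul_one]
  simp [fold, cubeProj_apply, this]
  ring

/-- The reflected walk in the unit cube with steps of size `h`. -/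
def scaledWalk {E : Type*} (f : Eucl d → E → ℝ → Eucl d) (h : ℝ) (s : Eucl d)
    (ξ : ℕ → E) (U : ℕ → ℝ) : ℕ → Eucl d
  | 0 => s
  | n + 1 => fold 1 (scaledWalk f h s ξ U n + h • f (scaledWalk f h s ξ U n) (ξ n) (U n))

section Walk

variable {E : Type*} {f : Eucl d → E → ℝ → Eucl d} {h : ℝ} {s : Eucl d} {ξ : ℕ → E} {U : ℕ → ℝ}

lemma walk_eq_smul_scaledWalk {m : ℕ} (hm : 1 ≤ m) (n : ℕ) :
    walk f m ((m : ℝ) • s) ξ U n = (m : ℝ) • scaledWalk f (m : ℝ)⁻¹ s ξ U n := by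
  have hm0 : (m : ℝ) ≠ 0 := by positivity
  induction n with
  | zero => rfl
  | succ n ih =>
    rw [walk, scaledWalk, ih, inv_smul_smul₀ hm0, ← fold_smul (Nat.cast_nonneg m), smul_add,
      smul_inv_smul₀ hm0]

lemma scaledWalk_mem_cube (hf : ∀ y i u, ‖f y i u‖ ≤ 1) (hs : s ∈ cube d) (h0 : 0 ≤ h)
    (h1 : h ≤ 1) (n : ℕ) : scaledWalk f h s ξ U n ∈ cube d := by
  induction n with
  | zero => exact hs
  | succ n ih =>
    refine fold_mem_cube ih ?_
    rw [add_sub_cancel_left, norm_smul, Real.norm_of_nonneg h0]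
    exact mul_le_one₀ h1 (norm_nonneg _) (hf _ _ _)

/-- The walk at time n depends on the strict past only. This plays the role of adaptedness to a
filtration. -/
lemma scaledWalk_congr {ξ' : ℕ → E} {U' : ℕ → ℝ} {n : ℕ} (hξ : ∀ j < n, ξ j = ξ' j)
    (hU : ∀ j < n, U j = U' j) : scaledWalk f h s ξ U n = scaledWalk f h s ξ' U' n := by
  induction n with
  | zero => rfl
  | succ n ih =>
    rw [scaledWalk, scaledWalk, ih (fun j hj => hξ j (hj.trans n.lt_succ_self))
      (fun j hj => hU j (hj.trans n.lt_succ_self)), hξ n n.lt_succ_self, hU n n.lt_succ_self]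

lemma norm_smul_step_le (hf : ∀ y i u, ‖f y i u‖ ≤ 1) (h0 : 0 ≤ h) (y : Eucl d) (i : E) (u : ℝ) :
    ‖h • f y i u‖ ≤ h := by
  rw [norm_smul, Real.norm_of_nonneg h0]
  exact mul_le_of_le_one_right h0 (hf _ _ _)

lemma norm_scaledWalk_succ_sub_le (hf : ∀ y i u, ‖f y i u‖ ≤ 1) (hs : s ∈ cube d) (h0 : 0 ≤ h)
    (h1 : h ≤ 1) (n : ℕ) : ‖scaledWalk f h s ξ U (n + 1) - scaledWalk f h s ξ U n‖ ≤ 3 * h := by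
  refine (norm_fold_sub_le (scaledWalk_mem_cube hf hs h0 h1 n)).trans ?_
  rw [add_sub_cancel_left]
  linarith [norm_smul_step_le hf h0 (scaledWalk f h s ξ U n) (ξ n) (U n)]

/-- The correction made by the reflection. -/
def scaledPush (f : Eucl d → E → ℝ → Eucl d) (h : ℝ) (s : Eucl d) (ξ : ℕ → E) (U : ℕ → ℝ)
    (n : ℕ) : Eucl d :=
  scaledWalk f h s ξ U n + h • f (scaledWalk f h s ξ U n) (ξ n) (U n)
    - scaledWalk f h s ξ U (n + 1)

/-- The push is 2 (z - Πz), normal at Πz. Since Πz is within 2h of y and ‖z - Πz‖ ≤ h, moving the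
base point to y costs 2 · 2h · h. -/
lemma inner_scaledPush_ge (hf : ∀ y i u, ‖f y i u‖ ≤ 1) (hs : s ∈ cube d) (h0 : 0 ≤ h)
    (h1 : h ≤ 1) (n : ℕ) {w : Eucl d} (hw : w ∈ cube d) :
    -(4 * h ^ 2) ≤ inner ℝ (scaledWalk f h s ξ U n - w) (scaledPush f h s ξ U n) := by
  set y := scaledWalk f h s ξ U n with hy
  set z := y + h • f y (ξ n) (U n) with hz
  have hyc : y ∈ cube d := scaledWalk_mem_cube hf hs h0 h1 n
  have e : scaledPush f h s ξ U n = (2 : ℝ) • (z - cubeProj 1 z) := by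
    rw [scaledPush, scaledWalk, ← hy, ← hz, fold_one_eq]; abel
  have hzy : ‖z - y‖ ≤ h := by
    rw [hz, add_sub_cancel_left]; exact norm_smul_step_le hf h0 _ _ _
  have hzp := (norm_sub_cubeProj_le z hyc).trans hzy
  have h3 : ‖cubeProj 1 z - y‖ ≤ 2 * h := by
    have : cubeProj 1 z - y = (z - y) - (z - cubeProj 1 z) := by abel
    rw [this]
    exact (norm_sub_le _ _).trans (by linarith)
  have h4 := inner_cubeProj_nonneg z hw
  have h5 := real_inner_le_norm (cubeProj 1 z - y) (z - cubeProj 1 z)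
  have h6 : ‖cubeProj 1 z - y‖ * ‖z - cubeProj 1 z‖ ≤ 2 * h * h :=
    mul_le_mul h3 hzp (norm_nonneg _) (by positivity)
  have e2 : y - w = (cubeProj 1 z - w) - (cubeProj 1 z - y) := by abel
  rw [e, e2, real_inner_smul_right, inner_sub_left]
  nlinarith

end Walk

/-! ### The drift and the Poisson equation -/

section Drift

variable {E : Type*}

/-- The mean step at `x` in the environment `i`. -/
noncomputable def stepDrift (p : Eucl d → E → StepLabel d → ℝ) (x : Eucl d) (i : E) : Eucl d :=
  ∑ v, p x i v • stepVec v

lemma avgDrift_eq_sum [Fintype E] (p : Eucl d → E → StepLabel d → ℝ) (μ : E → ℝ) (x : Eucl d) :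
    avgDrift p μ x = ∑ i, μ i • stepDrift p x i := by
  simp only [avgDrift, stepDrift, Finset.sum_smul, Finset.smul_sum, smul_smul]
  exact Finset.sum_comm

lemma norm_stepDrift_le {p : Eucl d → E → StepLabel d → ℝ} (hp : ∀ x i v, 0 ≤ p x i v)
    (hp1 : ∀ x i, ∑ v, p x i v = 1) (x : Eucl d) (i : E) : ‖stepDrift p x i‖ ≤ 1 := by
  rw [← hp1 x i]
  refine norm_sum_le_of_le _ fun v _ => ?_
  rw [norm_smul, norm_stepVec, mul_one, Real.norm_of_nonneg (hp x i v)]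

lemma norm_stepDrift_sub_le {p : Eucl d → E → StepLabel d → ℝ} {K : ℝ}
    (hK : ∀ x y i v, |p x i v - p y i v| ≤ K * ‖x - y‖) (x y : Eucl d) (i : E) :
    ‖stepDrift p x i - stepDrift p y i‖ ≤ 2 * d * K * ‖x - y‖ := by
  rw [stepDrift, stepDrift, ← Finset.sum_sub_distrib]
  refine (norm_sum_le_of_le (f := fun v => p x i v • stepVec v - p y i v • stepVec v)
    (n := fun _ => K * ‖x - y‖) _ fun v _ => ?_).trans (le_of_eq ?_)
  · rw [← sub_smul, norm_smul, norm_stepVec, mul_one]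
    exact hK x y i v
  · simp; ring

variable [Fintype E]

lemma norm_sum_smul_le {F : Type*} [SeminormedAddCommGroup F] [NormedSpace ℝ F] {c : E → ℝ}
    {g : E → F} {B : ℝ} (hg : ∀ i, ‖g i‖ ≤ B) : ‖∑ i, c i • g i‖ ≤ (∑ i, |c i|) * B := by
  rw [Finset.sum_mul]
  refine norm_sum_le_of_le _ fun i _ => ?_
  rw [norm_smul, Real.norm_eq_abs]
  exact mul_le_mul_of_nonneg_left (hg i) (abs_nonneg _)

lemma IsInvariantProb.sum_abs {P : Matrix E E ℝ} {μ : E → ℝ} (hμ : IsInvariantProb P μ) :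
    ∑ i, |μ i| = 1 := by
  rw [← hμ.sum_eq_one]
  exact Finset.sum_congr rfl fun i _ => abs_of_nonneg (hμ.nonneg i)

variable [DecidableEq E]

/-- Maximum principle: at a maximum i₀ of φ, the average of φ i₀ - φ under each power of P is zero,
and irreducibility gives a power charging j. -/
lemma eq_const_of_mulVec_eq {P : Matrix E E ℝ} (hP : P ∈ Matrix.rowStochastic ℝ E)
    (hirr : P.IsIrreducible) {φ : E → ℝ} (hφ : P *ᵥ φ = φ) (i j : E) : φ i = φ j := by
  have : Nonempty E := ⟨i⟩
  obtain ⟨i₀, hi₀⟩ := Finite.exists_max φ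
  suffices h : ∀ j, φ j = φ i₀ by rw [h i, h j]
  intro j
  obtain ⟨k, -, hk⟩ := (Matrix.isIrreducible_iff_exists_pow_pos hirr.nonneg).1 hirr i₀ j
  have hPk : P ^ k ∈ Matrix.rowStochastic ℝ E := pow_mem hP k
  have hφk : P ^ k *ᵥ φ = φ := by
    clear hk hPk
    induction k with
    | zero => simp
    | succ k ih => rw [pow_succ, ← Matrix.mulVec_mulVec, hφ, ih]
  have h1 : ∑ l, (P ^ k) i₀ l * (φ i₀ - φ l) = 0 := by
    simp only [mul_sub, Finset.sum_sub_distrib, ← Finset.sum_mul]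
    rw [Matrix.sum_row_of_mem_rowStochastic hPk, one_mul, sub_eq_zero]
    exact (congrFun hφk i₀).symm
  have h2 := (Finset.sum_eq_zero_iff_of_nonneg fun l _ =>
    mul_nonneg (Matrix.nonneg_of_mem_rowStochastic hPk) (sub_nonneg.2 (hi₀ l))).1 h1 j
      (Finset.mem_univ j)
  rcases mul_eq_zero.1 h2 with h3 | h3
  · exact absurd h3 hk.ne'
  · linarith

/-- The operator T = 1 - P + (mean under μ) preserves the μ-mean, so a kernel element is harmonic
with mean zero, hence constant and zero. In finite dimension T is then onto, and the columns of G
are the preimages of the basis vectors; column k has mean μ k. -/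
theorem exists_poisson_kernel {P : Matrix E E ℝ} (hP : P ∈ Matrix.rowStochastic ℝ E)
    (hirr : P.IsIrreducible) {μ : E → ℝ} (hμ : IsInvariantProb P μ) :
    ∃ G : E → E → ℝ, ∀ i k, G i k - ∑ l, P i l * G l k = (if i = k then 1 else 0) - μ k := by
  have hinv (φ : E → ℝ) : ∑ i, μ i * (P *ᵥ φ) i = ∑ i, μ i * φ i := by
    have := Matrix.dotProduct_mulVec μ P φ
    rw [hμ.invariant] at this
    exact this
  set T : (E → ℝ) →ₗ[ℝ] (E → ℝ) :=
    { toFun := fun φ i => φ i - (P *ᵥ φ) i + ∑ k, μ k * φ k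
      map_add' := fun φ ψ => by
        ext i
        simp only [Matrix.mulVec_add, Pi.add_apply, mul_add, Finset.sum_add_distrib]; ring
      map_smul' := fun c φ => by
        ext i
        simp only [Matrix.mulVec_smul, Pi.smul_apply, smul_eq_mul, RingHom.id_apply, mul_add,
          mul_sub, Finset.mul_sum]
        congr 1
        exact Finset.sum_congr rfl fun k _ => by ring } with hT
  have hmean (φ : E → ℝ) : ∑ i, μ i * T φ i = ∑ k, μ k * φ k := by
    simp only [hT, LinearMap.coe_mk, AddHom.coe_mk, mul_add, mul_sub, Finset.sum_add_distrib,
      Finset.sum_sub_distrib, hinv, ← Finset.sum_mul, hμ.sum_eq_one]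
    ring
  have hinj : Function.Injective T := by
    rw [← LinearMap.ker_eq_bot, LinearMap.ker_eq_bot']
    intro φ hφ
    have h0 : ∑ k, μ k * φ k = 0 := by rw [← hmean φ, hφ]; simp
    have h1 : P *ᵥ φ = φ := by
      ext i
      have := congrFun hφ i
      simp only [hT, LinearMap.coe_mk, AddHom.coe_mk, h0, add_zero, Pi.zero_apply] at this
      linarith
    ext i
    have h2 : ∑ k, μ k * φ k = φ i := by
      rw [Finset.sum_congr rfl fun k _ => by rw [eq_const_of_mulVec_eq hP hirr h1 k i],
        ← Finset.sum_mul, hμ.sum_eq_one, one_mul]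
    rw [← h2, h0]; rfl
  have hsurj : Function.Surjective T := LinearMap.injective_iff_surjective.1 hinj
  choose φ hφ using fun k : E => hsurj (Pi.single k 1)
  refine ⟨fun i k => φ k i, fun i k => ?_⟩
  have h1 := hmean (φ k)
  rw [hφ k] at h1
  have h2 := congrFun (hφ k) i
  simp only [hT, LinearMap.coe_mk, AddHom.coe_mk, ← h1] at h2
  simp only [Pi.single_apply, mul_ite, mul_one, mul_zero, Finset.sum_ite_eq', Finset.mem_univ,
    if_true] at h2
  rw [← h2]
  simp [Matrix.mulVec, dotProduct]

end Drift

end ReflectedWalk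

namespace ReflectedWalk

/-! ### Maxima of sums of bounded orthogonal variables -/

section Orthogonal

variable {Ω : Type*} [MeasurableSpace Ω] {Pr : Measure Ω} [IsProbabilityMeasure Pr]
  {ζ : ℕ → Ω → ℝ} {c : ℝ}

lemma integral_sq_sum_le (hm : ∀ j, Measurable (ζ j)) (hc : ∀ j ω, |ζ j ω| ≤ c)
    (horth : ∀ i j, i < j → ∫ ω, ζ i ω * ζ j ω ∂Pr = 0) (n : ℕ) :
    ∫ ω, (∑ j ∈ Finset.range n, ζ j ω) ^ 2 ∂Pr ≤ n * c ^ 2 := by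
  have hb (f : Ω → ℝ) (hf : Measurable f) (C : ℝ) (hC : ∀ ω, |f ω| ≤ C) : Integrable f Pr :=
    Integrable.of_bound hf.aestronglyMeasurable C (Eventually.of_forall hC)
  have hS (n : ℕ) : Measurable fun ω => ∑ j ∈ Finset.range n, ζ j ω :=
    Finset.measurable_sum _ fun j _ => hm j
  have hSb (n : ℕ) (ω : Ω) : |∑ j ∈ Finset.range n, ζ j ω| ≤ n * c := by
    refine (Finset.abs_sum_le_sum_abs _ _).trans ?_
    refine (Finset.sum_le_sum fun j _ => hc j ω).trans (by simp)
  have hmul {f g : Ω → ℝ} {a b : ℝ} (hf : ∀ ω, |f ω| ≤ a) (hg : ∀ ω, |g ω| ≤ b) (ω : Ω) :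
      |f ω * g ω| ≤ a * b := by
    rw [abs_mul]
    exact mul_le_mul (hf ω) (hg ω) (abs_nonneg _) ((abs_nonneg _).trans (hf ω))
  induction n with
  | zero => simp
  | succ n ih =>
    have e (ω : Ω) : (∑ j ∈ Finset.range (n + 1), ζ j ω) ^ 2 =
        (∑ j ∈ Finset.range n, ζ j ω) ^ 2 + (2 * ∑ j ∈ Finset.range n, ζ j ω * ζ n ω
          + ζ n ω * ζ n ω) := by
      rw [Finset.sum_range_succ, ← Finset.sum_mul]; ring
    have i1 : Integrable (fun ω => (∑ j ∈ Finset.range n, ζ j ω) ^ 2) Pr := by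
      simp_rw [sq]
      exact hb _ ((hS n).mul (hS n)) _ (hmul (hSb n) (hSb n))
    have i2 (j : ℕ) : Integrable (fun ω => ζ j ω * ζ n ω) Pr :=
      hb _ ((hm j).mul (hm n)) _ (hmul (hc j) (hc n))
    have i3 : Integrable (fun ω => 2 * ∑ j ∈ Finset.range n, ζ j ω * ζ n ω) Pr :=
      (integrable_finsetSum _ fun j _ => i2 j).const_mul 2
    have i4 : Integrable (fun ω => 2 * ∑ j ∈ Finset.range n, ζ j ω * ζ n ω + ζ n ω * ζ n ω) Pr :=
      i3.add (i2 n)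
    simp_rw [e]
    rw [integral_add i1 i4, integral_add i3 (i2 n), integral_const_mul,
      integral_finsetSum _ fun j _ => i2 j,
      Finset.sum_eq_zero fun j hj => horth j n (Finset.mem_range.1 hj)]
    have : ∫ ω, ζ n ω * ζ n ω ∂Pr ≤ c ^ 2 := by
      have h1 := integral_mono (μ := Pr) (i2 n) (integrable_const (c ^ 2)) fun ω => by
        have := (le_abs_self _).trans (hmul (hc n) (hc n) ω)
        simpa [sq] using this
      simpa using h1
    push_cast
    linarith

lemma measure_le_abs_sum_le (hm : ∀ j, Measurable (ζ j)) (hc : ∀ j ω, |ζ j ω| ≤ c)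
    (horth : ∀ i j, i < j → ∫ ω, ζ i ω * ζ j ω ∂Pr = 0) (n : ℕ) {a : ℝ} (ha : 0 < a) :
    Pr {ω | a ≤ |∑ j ∈ Finset.range n, ζ j ω|} ≤ ENNReal.ofReal (n * c ^ 2 / a ^ 2) := by
  have hS : Measurable fun ω => ∑ j ∈ Finset.range n, ζ j ω :=
    Finset.measurable_sum _ fun j _ => hm j
  have hi : Integrable (fun ω => (∑ j ∈ Finset.range n, ζ j ω) ^ 2) Pr := by
    refine Integrable.of_bound (hS.pow_const 2).aestronglyMeasurable ((n * c) ^ 2)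
      (Eventually.of_forall fun ω => ?_)
    rw [Real.norm_of_nonneg (sq_nonneg _), ← sq_abs]
    refine pow_le_pow_left₀ (abs_nonneg _) ?_ 2
    refine (Finset.abs_sum_le_sum_abs _ _).trans ?_
    refine (Finset.sum_le_sum fun j _ => hc j ω).trans (by simp)
  have h1 := mul_meas_ge_le_integral_of_nonneg (μ := Pr)
    (Eventually.of_forall fun ω => sq_nonneg (∑ j ∈ Finset.range n, ζ j ω)) hi (a ^ 2)
  have h2 := h1.trans (integral_sq_sum_le hm hc horth n)
  have e : {ω | a ≤ |∑ j ∈ Finset.range n, ζ j ω|} =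
      {ω | a ^ 2 ≤ (∑ j ∈ Finset.range n, ζ j ω) ^ 2} := by
    ext ω
    change a ≤ _ ↔ a ^ 2 ≤ _
    rw [← sq_abs (∑ j ∈ Finset.range n, ζ j ω), sq_le_sq₀ ha.le (abs_nonneg _)]
  rw [e, ← ENNReal.ofReal_toReal (measure_ne_top Pr _)]
  refine ENNReal.ofReal_le_ofReal ?_
  rw [le_div_iff₀ (by positivity), mul_comm]
  exact h2

/-- A substitute for a maximal inequality: between multiples of s the sum moves by at most s c ≤ a,
so exceeding 2a forces exceeding a at one of the R + 1 multiples up to s R, where Chebyshev's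
inequality applies. -/
lemma measure_exists_le_abs_sum_le (hm : ∀ j, Measurable (ζ j)) (hc : ∀ j ω, |ζ j ω| ≤ c)
    (horth : ∀ i j, i < j → ∫ ω, ζ i ω * ζ j ω ∂Pr = 0) {N s R : ℕ} (hs : 0 < s)
    (hN : N < s * (R + 1)) {a : ℝ} (ha : 0 < a) (hsa : s * c ≤ a) :
    Pr {ω | ∃ n ≤ N, 2 * a ≤ |∑ j ∈ Finset.range n, ζ j ω|} ≤
      (R + 1) * ENNReal.ofReal (s * R * c ^ 2 / a ^ 2) := by
  have hsub : {ω | ∃ n ≤ N, 2 * a ≤ |∑ j ∈ Finset.range n, ζ j ω|} ⊆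
      ⋃ r ∈ Finset.range (R + 1), {ω | a ≤ |∑ j ∈ Finset.range (s * r), ζ j ω|} := by
    rintro ω ⟨n, hn, hω⟩
    have hr : n / s < R + 1 := Nat.div_lt_of_lt_mul (hn.trans_lt hN)
    refine mem_iUnion₂.2 ⟨n / s, Finset.mem_range.2 hr, ?_⟩
    have hc0 : 0 ≤ c := (abs_nonneg _).trans (hc 0 ω)
    have hle : s * (n / s) ≤ n := Nat.mul_div_le n s
    have h1 := Finset.sum_range_add_sum_Ico (fun j => ζ j ω) hle
    have h2 := norm_sum_Ico_le (f := fun j => ζ j ω) hle fun j _ _ => hc j ω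
    have h3 : ((n : ℝ) - (s * (n / s) : ℕ)) * c ≤ s * c := by
      refine mul_le_mul_of_nonneg_right ?_ hc0
      have := Nat.mod_lt n hs
      have h4 := Nat.div_add_mod n s
      rw [sub_le_iff_le_add]
      exact_mod_cast (show n ≤ s + s * (n / s) by omega)
    have h5 := abs_add_le (∑ j ∈ Finset.range (s * (n / s)), ζ j ω)
      (∑ j ∈ Finset.Ico (s * (n / s)) n, ζ j ω)
    rw [h1] at h5
    rw [Real.norm_eq_abs] at h2
    change a ≤ _
    linarith
  refine (measure_mono hsub).trans ((measure_biUnion_finset_le _ _).trans ?_)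
  refine (Finset.sum_le_sum fun r hr => (measure_le_abs_sum_le hm hc horth (s * r) ha).trans
    (ENNReal.ofReal_le_ofReal ?_)).trans (le_of_eq ?_) (b := ∑ r ∈ Finset.range (R + 1),
      ENNReal.ofReal (s * R * c ^ 2 / a ^ 2))
  · have : (r : ℝ) ≤ R := by exact_mod_cast Nat.lt_succ_iff.1 (Finset.mem_range.1 hr)
    push_cast
    gcongr
  · simp

/-- With blocks of length proportional to m, the number of block ends is fixed while each Chebyshev
bound is O(1/m). -/
theorem tendsto_measure_exists_le_abs_sum {ζ : ℕ → ℕ → Ω → ℝ}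
    (hm : ∀ m, 1 ≤ m → ∀ j, Measurable (ζ m j)) (hc : ∀ m, 1 ≤ m → ∀ j ω, |ζ m j ω| ≤ c)
    (horth : ∀ m, 1 ≤ m → ∀ i j, i < j → ∫ ω, ζ m i ω * ζ m j ω ∂Pr = 0)
    {T η : ℝ} (hT : 0 < T) (hη : 0 < η) :
    Tendsto (fun m : ℕ => Pr {ω | ∃ n : ℕ, n ≤ m * T ∧
      η * m ≤ |∑ j ∈ Finset.range n, ζ m j ω|}) atTop (𝓝 0) := by
  obtain ⟨ω₀⟩ : Nonempty Ω := nonempty_of_isProbabilityMeasure Pr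
  have hc0 : 0 ≤ c := (abs_nonneg _).trans (hc 1 le_rfl 0 ω₀)
  -- Chosen so that a block of length γ m moves the sum by at most η m / 2; the + 1 covers c = 0.
  set γ : ℝ := η / (2 * (c + 1)) with hγ
  have hγ0 : 0 < γ := by positivity
  have hγc : γ * c ≤ η / 2 := by
    rw [hγ, div_mul_eq_mul_div, div_le_div_iff₀ (by positivity) (by positivity)]
    nlinarith
  -- The factor 2 absorbs the integer part: s ≥ 1 and s + 1 > γ m give s ≥ γ m / 2.
  obtain ⟨R, hR⟩ := exists_nat_gt (2 * T / γ)
  have hlim : Tendsto (fun m : ℕ => ((R : ℝ≥0∞) + 1) *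
      ENNReal.ofReal ((γ * R * c ^ 2 / (η / 2) ^ 2) / m)) atTop (𝓝 0) := by
    have h1 := ENNReal.tendsto_ofReal (tendsto_const_div_atTop_nhds_zero_nat
      (γ * R * c ^ 2 / (η / 2) ^ 2))
    have h2 := ENNReal.Tendsto.const_mul h1 (a := (R : ℝ≥0∞) + 1) (Or.inr (by simp))
    simpa using h2
  refine tendsto_of_tendsto_of_tendsto_of_le_of_le' tendsto_const_nhds hlim
    (Eventually.of_forall fun _ => zero_le) ?_
  obtain ⟨m₀, hm₀⟩ := exists_nat_gt (1 / γ)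
  filter_upwards [eventually_ge_atTop (max 1 m₀)] with m hmm
  have hm1 : 1 ≤ m := (le_max_left _ _).trans hmm
  have hmpos : (0 : ℝ) < m := by exact_mod_cast hm1
  have hγm : 1 < γ * m := by
    have : 1 / γ < m := hm₀.trans_le (by exact_mod_cast (le_max_right _ _).trans hmm)
    rwa [div_lt_iff₀ hγ0, mul_comm] at this
  set s : ℕ := ⌊γ * m⌋₊ with hs
  have hs1 : (s : ℝ) ≤ γ * m := Nat.floor_le (by positivity)
  have hs2 : γ * m < s + 1 := Nat.lt_floor_add_one _
  have hs0 : 0 < s := Nat.floor_pos.2 hγm.le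
  have hs0' : (1 : ℝ) ≤ s := by exact_mod_cast hs0
  have hN : ⌊m * T⌋₊ < s * (R + 1) := by
    rw [Nat.floor_lt (by positivity)]
    push_cast
    rw [div_lt_iff₀ hγ0] at hR
    nlinarith
  have hbound := measure_exists_le_abs_sum_le (Pr := Pr) (hm m hm1) (hc m hm1) (horth m hm1)
    hs0 hN (a := η / 2 * m) (by positivity) (by
      calc (s : ℝ) * c ≤ γ * m * c := mul_le_mul_of_nonneg_right hs1 hc0
        _ = γ * c * m := by ring
        _ ≤ η / 2 * m := mul_le_mul_of_nonneg_right hγc hmpos.le)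
  refine (measure_mono ?_).trans (hbound.trans ?_)
  · rintro ω ⟨n, hn, hω⟩
    refine ⟨n, Nat.le_floor hn, ?_⟩
    linarith
  · refine mul_le_mul_right (ENNReal.ofReal_le_ofReal ?_) _
    calc s * R * c ^ 2 / (η / 2 * m) ^ 2 ≤ (γ * m) * R * c ^ 2 / (η / 2 * m) ^ 2 := by gcongr
      _ = (γ * R * c ^ 2 / (η / 2) ^ 2) / m := by field_simp

end Orthogonal

end ReflectedWalk

namespace ReflectedWalk

/-! ### Vanishing expectations from independence and from the Markov property -/

section Vanishing

variable {Ω : Type*} [MeasurableSpace Ω] {Pr : Measure Ω} [IsProbabilityMeasure Pr]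

lemma integral_eq_zero_of_indepFun {α β : Type*} [MeasurableSpace α] [MeasurableSpace β]
    {X : Ω → α} {Y : Ω → β} (hX : Measurable X) (hY : Measurable Y) (h : IndepFun X Y Pr)
    {G : α → β → ℝ} (hG : Measurable fun q : α × β => G q.1 q.2) {c : ℝ} (hc : ∀ x y, |G x y| ≤ c)
    (h0 : ∀ x, ∫ ω, G x (Y ω) ∂Pr = 0) : ∫ ω, G (X ω) (Y ω) ∂Pr = 0 := by
  have hXp : IsProbabilityMeasure (Pr.map X) := Measure.isProbabilityMeasure_map hX.aemeasurable
  have hYp : IsProbabilityMeasure (Pr.map Y) := Measure.isProbabilityMeasure_map hY.aemeasurable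
  have h1 : ∫ ω, G (X ω) (Y ω) ∂Pr =
      ∫ q : α × β, G q.1 q.2 ∂(Pr.map fun ω => (X ω, Y ω)) :=
    (integral_map (hX.prodMk hY).aemeasurable hG.aestronglyMeasurable).symm
  rw [h1, (indepFun_iff_map_prod_eq_prod_map_map hX.aemeasurable hY.aemeasurable).1 h,
    integral_prod _ (Integrable.of_bound hG.aestronglyMeasurable c
      (Eventually.of_forall fun q => hc q.1 q.2))]
  refine integral_eq_zero_of_ae (Eventually.of_forall fun x => ?_)
  simp only [Pi.zero_apply]
  have hm : Measurable fun y => G x y := hG.comp measurable_prodMk_left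
  rw [integral_map hY.aemeasurable hm.aestronglyMeasurable]
  exact h0 x

variable {E : Type*} [MeasurableSpace E] {ξ : ℕ → Ω → E} {U : ℕ → Ω → ℝ}

lemma measurable_path {F : Type*} [MeasurableSpace F] {Z : ℕ → Ω → F}
    (hZ : ∀ n, Measurable (Z n)) : Measurable fun ω n => Z n ω :=
  measurable_pi_lambda _ hZ

/-- Independence is used twice: to freeze the environment, then to separate U_j from the earlier
U_i, the only ones F sees by `hdep`. -/
theorem integral_eq_zero_of_uniform (hξ : ∀ n, Measurable (ξ n)) (hU : ∀ n, Measurable (U n))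
    (hlaw : ∀ n, Pr.map (U n) = volume.restrict (Ioo (0 : ℝ) 1)) (hind : iIndepFun U Pr)
    (hUξ : IndepFun (fun ω n => U n ω) (fun ω n => ξ n ω) Pr) {j : ℕ}
    {F : (ℕ → E) → (ℕ → ℝ) → ℝ → ℝ}
    (hF : Measurable fun q : (ℕ → E) × (ℕ → ℝ) × ℝ => F q.1 q.2.1 q.2.2)
    {c : ℝ} (hc : ∀ e w u, |F e w u| ≤ c)
    (hdep : ∀ e w w' u, (∀ i < j, w i = w' i) → F e w u = F e w' u)
    (h0 : ∀ e w, ∫ u in Ioo (0 : ℝ) 1, F e w u = 0) :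
    ∫ ω, F (fun n => ξ n ω) (fun n => U n ω) (U j ω) ∂Pr = 0 := by
  refine integral_eq_zero_of_indepFun (X := fun ω n => ξ n ω) (Y := fun ω n => U n ω)
    (G := fun e w => F e w (w j)) (measurable_path hξ) (measurable_path hU) hUξ.symm ?_
    (c := c) (fun _ _ => hc _ _ _) fun e => ?_
  · have : Measurable fun q : (ℕ → E) × (ℕ → ℝ) => (q.1, q.2, q.2 j) := by fun_prop
    exact hF.comp this
  -- Padding with zeros from index j on is harmless by `hdep`.
  · set ext : (↥(Finset.range j) → ℝ) → ℕ → ℝ :=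
      fun a n => if h : n ∈ Finset.range j then a ⟨n, h⟩ else 0 with hext
    have hextm : Measurable ext := by
      refine measurable_pi_lambda _ fun n => ?_
      by_cases h : n ∈ Finset.range j
      · simp only [hext, h, dif_pos]; fun_prop
      · simp only [hext, h, dif_neg, not_false_eq_true]; fun_prop
    have hsing : Measurable fun a : ↥({j} : Finset ℕ) → ℝ => a ⟨j, Finset.mem_singleton_self j⟩ :=
      measurable_pi_apply _
    have hI : IndepFun (fun ω => ext fun i : ↥(Finset.range j) => U i ω) (U j) Pr :=
      (hind.indepFun_finset (Finset.range j) {j} (by simp) hU).comp hextm hsing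
    have e1 (ω : Ω) : F e (fun n => U n ω) (U j ω) =
        F e (ext fun i : ↥(Finset.range j) => U i ω) (U j ω) :=
      hdep _ _ _ _ fun i hi => by simp [hext, hi]
    simp_rw [e1]
    refine integral_eq_zero_of_indepFun (G := fun w u => F e w u)
      (hextm.comp (measurable_pi_lambda _ fun i => hU i)) (hU j) hI
      (hF.comp measurable_prodMk_left) (hc e) fun w => ?_
    have hm : Measurable fun u => F e w u :=
      hF.comp (measurable_prodMk_left.comp measurable_prodMk_left)
    rw [← integral_map (hU j).aemeasurable (f := fun u => F e w u) hm.aestronglyMeasurable, hlaw]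
    exact h0 e w

variable [Fintype E] [MeasurableSingletonClass E]

lemma integral_eq_zero_of_markov (hξ : ∀ n, Measurable (ξ n)) {P : Matrix E E ℝ}
    (hP : ∀ i j, 0 ≤ P i j) (hM : IsMarkovChain Pr P ξ) {n : ℕ} {H : (ℕ → E) → E → ℝ}
    (hdep : ∀ e e' k, (∀ i ≤ n, e i = e' i) → H e k = H e' k)
    (h0 : ∀ e, ∑ k, P (e n) k * H e k = 0) :
    ∫ ω, H (fun i => ξ i ω) (ξ (n + 1) ω) ∂Pr = 0 := by
  -- A finite path is continued by its last state, so `ext a n` is the state from which the next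
  -- transition starts.
  set ext : (Fin (n + 1) → E) → ℕ → E := fun a i => a ⟨min i n, by omega⟩ with hext
  set Y : Ω → (Fin (n + 1) → E) × E := fun ω => (fun i => ξ i ω, ξ (n + 1) ω) with hY
  have hYm : Measurable Y :=
    Measurable.prodMk (measurable_pi_lambda _ fun i => hξ i) (hξ (n + 1))
  have e1 (ω : Ω) : H (fun i => ξ i ω) (ξ (n + 1) ω) = (fun q => H (ext q.1) q.2) (Y ω) :=
    hdep _ _ _ fun i hi => by simp [hext, hY, hi]
  simp_rw [e1]
  have hmf : Measurable fun q : (Fin (n + 1) → E) × E => H (ext q.1) q.2 := measurable_of_finite _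
  have hprob : IsProbabilityMeasure (Pr.map Y) := Measure.isProbabilityMeasure_map hYm.aemeasurable
  rw [← integral_map hYm.aemeasurable hmf.aestronglyMeasurable, integral_fintype .of_finite,
    Fintype.sum_prod_type]
  refine Finset.sum_eq_zero fun a _ => ?_
  have hprobY (k : E) : (Pr.map Y).real {(a, k)} =
      (Pr {ω | ∀ i ≤ n, ξ i ω = ext a i}).toReal * P (ext a n) k := by
    -- Only the values up to time n + 1 matter, so the path may stay at k afterwards.
    have h1 := hM n fun i => if i ≤ n then ext a i else k
    simp only [le_refl, if_true, show ¬ n + 1 ≤ n by omega, if_false] at h1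
    have h2 : {ω | ∀ i ≤ n + 1, ξ i ω = if i ≤ n then ext a i else k} = Y ⁻¹' {(a, k)} := by
      ext ω
      simp only [mem_preimage, mem_singleton_iff, hY, Prod.mk.injEq, funext_iff]
      constructor
      · intro h
        refine ⟨fun i => ?_, ?_⟩
        · have hi : i.val ≤ n := by omega
          have := h i.val (by omega)
          rw [if_pos hi] at this
          rw [this]
          simp only [hext]
          congr 1
          exact Fin.ext (min_eq_left hi)
        · have := h (n + 1) le_rfl
          rwa [if_neg (by omega)] at this
      · rintro ⟨h3, h4⟩ i hi
        by_cases hin : i ≤ n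
        · rw [if_pos hin]
          have := h3 ⟨i, by omega⟩
          simp only [hext] at this ⊢
          rw [this]
          congr 1
          exact Fin.ext (min_eq_left hin).symm
        · rw [if_neg hin, show i = n + 1 by omega]; exact h4
    have h3 : {ω | ∀ i ≤ n, ξ i ω = if i ≤ n then ext a i else k} =
        {ω | ∀ i ≤ n, ξ i ω = ext a i} := by
      ext ω
      exact forall₂_congr fun i hi => by rw [if_pos hi]
    rw [h2, h3] at h1
    rw [map_measureReal_apply hYm (measurableSet_singleton _), Measure.real, h1,
      ENNReal.toReal_mul, ENNReal.toReal_ofReal (hP _ _)]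
  simp_rw [hprobY, smul_eq_mul, mul_assoc]
  rw [← Finset.mul_sum, h0, mul_zero]

/-- Freezing the uniform variables, by independence, reduces this to the chain alone. -/
theorem integral_eq_zero_of_markov_indep (hξ : ∀ n, Measurable (ξ n)) (hU : ∀ n, Measurable (U n))
    (hUξ : IndepFun (fun ω n => U n ω) (fun ω n => ξ n ω) Pr) {P : Matrix E E ℝ}
    (hP : ∀ i j, 0 ≤ P i j) (hM : IsMarkovChain Pr P ξ) {n : ℕ}
    {F : (ℕ → E) → (ℕ → ℝ) → E → ℝ}
    (hF : Measurable fun q : (ℕ → E) × (ℕ → ℝ) × E => F q.1 q.2.1 q.2.2)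
    {c : ℝ} (hc : ∀ e w u, |F e w u| ≤ c)
    (hdep : ∀ e e' w k, (∀ i ≤ n, e i = e' i) → F e w k = F e' w k)
    (h0 : ∀ e w, ∑ k, P (e n) k * F e w k = 0) :
    ∫ ω, F (fun i => ξ i ω) (fun i => U i ω) (ξ (n + 1) ω) ∂Pr = 0 := by
  refine integral_eq_zero_of_indepFun (X := fun ω i => U i ω) (Y := fun ω i => ξ i ω)
    (G := fun w e => F e w (e (n + 1))) (measurable_path hU) (measurable_path hξ) hUξ ?_
    (c := c) (fun _ _ => hc _ _ _) fun w => ?_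
  · have : Measurable fun q : (ℕ → ℝ) × (ℕ → E) => (q.2, q.1, q.2 (n + 1)) := by fun_prop
    exact hF.comp this
  · exact integral_eq_zero_of_markov hξ hP hM (H := fun e k => F e w k)
      (fun e e' k h => hdep e e' w k h) fun e => h0 e w

end Vanishing

end ReflectedWalk

namespace ReflectedWalk

/-! ### The two noises of the walk -/

section Noise

variable {d : ℕ} {E : Type*} {f : Eucl d → E → ℝ → Eucl d} {g H H' : Eucl d → E → Eucl d}
  {h : ℝ} {s : Eucl d} {D : ℕ → Eucl d → Eucl d}

/-- The noise due to the choice `u` of the step at time `j`. -/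
noncomputable def stepNoise (f : Eucl d → E → ℝ → Eucl d) (g : Eucl d → E → Eucl d) (h : ℝ) (s : Eucl d)
    (D : ℕ → Eucl d → Eucl d) (j : ℕ) (e : ℕ → E) (w : ℕ → ℝ) (u : ℝ) : ℝ :=
  inner ℝ (D j (scaledWalk f h s e w j))
    (f (scaledWalk f h s e w j) (e j) u - g (scaledWalk f h s e w j) (e j))

/-- The noise due to the transition of the environment to the state `k` at time `j + 1`. -/
noncomputable def envNoise (f : Eucl d → E → ℝ → Eucl d) (H H' : Eucl d → E → Eucl d) (h : ℝ) (s : Eucl d)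
    (D : ℕ → Eucl d → Eucl d) (j : ℕ) (e : ℕ → E) (w : ℕ → ℝ) (k : E) : ℝ :=
  inner ℝ (D j (scaledWalk f h s e w j))
    (H (scaledWalk f h s e w j) k - H' (scaledWalk f h s e w j) (e j))

lemma abs_inner_sub_le {R B : ℝ} {a b c : Eucl d} (ha : ‖a‖ ≤ R) (hb : ‖b‖ ≤ B) (hc : ‖c‖ ≤ B) :
    |inner ℝ a (b - c)| ≤ R * (2 * B) := by
  refine (abs_real_inner_le_norm _ _).trans (mul_le_mul ha ?_ (norm_nonneg _)
    ((norm_nonneg _).trans ha))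
  exact (norm_sub_le _ _).trans (by linarith)

lemma abs_mul_le_sq {a b c : ℝ} (ha : |a| ≤ c) (hb : |b| ≤ c) : |a * b| ≤ c ^ 2 := by
  rw [abs_mul, sq]
  exact mul_le_mul ha hb (abs_nonneg _) ((abs_nonneg _).trans ha)

lemma stepNoise_congr {j : ℕ} {e : ℕ → E} {w w' : ℕ → ℝ} {u : ℝ} (hw : ∀ i < j, w i = w' i) :
    stepNoise f g h s D j e w u = stepNoise f g h s D j e w' u := by
  rw [stepNoise, stepNoise, scaledWalk_congr (fun _ _ => rfl) hw]

lemma envNoise_congr {j : ℕ} {e e' : ℕ → E} {w : ℕ → ℝ} {k : E} (he : ∀ i ≤ j, e i = e' i) :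
    envNoise f H H' h s D j e w k = envNoise f H H' h s D j e' w k := by
  rw [envNoise, envNoise, scaledWalk_congr (fun i hi => he i hi.le) (fun _ _ => rfl), he j le_rfl]

section Bounds

variable {R B : ℝ} (hf : ∀ y i u, ‖f y i u‖ ≤ 1) (hs : s ∈ cube d) (h0 : 0 ≤ h) (h1 : h ≤ 1)
  (hD : ∀ j, ∀ y ∈ cube d, ‖D j y‖ ≤ R)

include hf hs h0 h1 hD

lemma abs_stepNoise_le (hg : ∀ y i, ‖g y i‖ ≤ 1) (j : ℕ) (e : ℕ → E) (w : ℕ → ℝ) (u : ℝ) :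
    |stepNoise f g h s D j e w u| ≤ R * (2 * 1) :=
  abs_inner_sub_le (hD j _ (scaledWalk_mem_cube hf hs h0 h1 j)) (hf _ _ _) (hg _ _)

lemma abs_envNoise_le (hH : ∀ y i, ‖H y i‖ ≤ B) (hH' : ∀ y i, ‖H' y i‖ ≤ B) (j : ℕ) (e : ℕ → E)
    (w : ℕ → ℝ) (k : E) : |envNoise f H H' h s D j e w k| ≤ R * (2 * B) :=
  abs_inner_sub_le (hD j _ (scaledWalk_mem_cube hf hs h0 h1 j)) (hH _ _) (hH' _ _)

end Bounds

variable [MeasurableSpace E]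

lemma measurable_fold : Measurable (fold 1 : Eucl d → Eucl d) := by
  have h1 : Continuous (cubeProj 1 : Eucl d → Eucl d) := by
    unfold cubeProj
    fun_prop
  unfold fold
  exact ((h1.const_smul (2 : ℝ)).sub continuous_id).measurable

lemma measurable_scaledWalk (hfm : Measurable fun q : Eucl d × E × ℝ => f q.1 q.2.1 q.2.2)
    {α : Type*} [MeasurableSpace α] {e : α → ℕ → E} {w : α → ℕ → ℝ} (he : Measurable e)
    (hw : Measurable w) (n : ℕ) : Measurable fun a => scaledWalk f h s (e a) (w a) n := by
  induction n with
  | zero => exact measurable_const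
  | succ n ih =>
    have h1 : Measurable fun a => (scaledWalk f h s (e a) (w a) n, e a n, w a n) := by fun_prop
    exact measurable_fold.comp (ih.add ((hfm.comp h1).const_smul h))

lemma measurable_stepNoise (hfm : Measurable fun q : Eucl d × E × ℝ => f q.1 q.2.1 q.2.2)
    (hgm : Measurable fun q : Eucl d × E => g q.1 q.2) (hDm : ∀ j, Measurable (D j))
    {α : Type*} [MeasurableSpace α] {e : α → ℕ → E} {w : α → ℕ → ℝ} {u : α → ℝ}
    (he : Measurable e) (hw : Measurable w) (hu : Measurable u) (j : ℕ) :
    Measurable fun a => stepNoise f g h s D j (e a) (w a) (u a) := by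
  have hy := measurable_scaledWalk (h := h) (s := s) hfm he hw j
  have h1 : Measurable fun a => (scaledWalk f h s (e a) (w a) j, e a j, u a) := by fun_prop
  have h2 : Measurable fun a => (scaledWalk f h s (e a) (w a) j, e a j) := by fun_prop
  exact ((hDm j).comp hy).inner ((hfm.comp h1).sub (hgm.comp h2))

lemma measurable_envNoise (hfm : Measurable fun q : Eucl d × E × ℝ => f q.1 q.2.1 q.2.2)
    (hHm : Measurable fun q : Eucl d × E => H q.1 q.2)
    (hHm' : Measurable fun q : Eucl d × E => H' q.1 q.2) (hDm : ∀ j, Measurable (D j))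
    {α : Type*} [MeasurableSpace α] {e : α → ℕ → E} {w : α → ℕ → ℝ} {k : α → E}
    (he : Measurable e) (hw : Measurable w) (hk : Measurable k) (j : ℕ) :
    Measurable fun a => envNoise f H H' h s D j (e a) (w a) (k a) := by
  have hy := measurable_scaledWalk (h := h) (s := s) hfm he hw j
  have h1 : Measurable fun a => (scaledWalk f h s (e a) (w a) j, k a) := by fun_prop
  have h2 : Measurable fun a => (scaledWalk f h s (e a) (w a) j, e a j) := by fun_prop
  exact ((hDm j).comp hy).inner ((hHm.comp h1).sub (hHm'.comp h2))

variable {Ω : Type*} [MeasurableSpace Ω] {Pr : Measure Ω} [IsProbabilityMeasure Pr]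
  {ξ : ℕ → Ω → E} {U : ℕ → Ω → ℝ} {R B : ℝ}

theorem integral_stepNoise_mul_eq_zero (hξ : ∀ n, Measurable (ξ n)) (hU : ∀ n, Measurable (U n))
    (hlaw : ∀ n, Pr.map (U n) = volume.restrict (Ioo (0 : ℝ) 1)) (hind : iIndepFun U Pr)
    (hUξ : IndepFun (fun ω n => U n ω) (fun ω n => ξ n ω) Pr)
    (hfm : Measurable fun q : Eucl d × E × ℝ => f q.1 q.2.1 q.2.2)
    (hgm : Measurable fun q : Eucl d × E => g q.1 q.2) (hDm : ∀ j, Measurable (D j))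
    (hf : ∀ y i u, ‖f y i u‖ ≤ 1) (hg : ∀ y i, ‖g y i‖ ≤ 1) (hs : s ∈ cube d) (h0 : 0 ≤ h)
    (h1 : h ≤ 1) (hD : ∀ j, ∀ y ∈ cube d, ‖D j y‖ ≤ R)
    (hfg : ∀ y i, ∫ u in Ioo (0 : ℝ) 1, f y i u = g y i) {i j : ℕ} (hij : i < j) :
    ∫ ω, stepNoise f g h s D i (fun n => ξ n ω) (fun n => U n ω) (U i ω) *
      stepNoise f g h s D j (fun n => ξ n ω) (fun n => U n ω) (U j ω) ∂Pr = 0 := by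
  -- The earlier noise is a function of the environment and of the w l with l ≤ i < j, so it factors
  -- out of the integral over u.
  refine integral_eq_zero_of_uniform hξ hU hlaw hind hUξ (j := j)
    (F := fun e w u => stepNoise f g h s D i e w (w i) * stepNoise f g h s D j e w u)
    (c := (R * (2 * 1)) ^ 2) ?_ (fun e w u => ?_) (fun e w w' u hw => ?_) fun e w => ?_
  · exact (measurable_stepNoise hfm hgm hDm (by fun_prop) (by fun_prop) (by fun_prop) i).mul
      (measurable_stepNoise hfm hgm hDm (by fun_prop) (by fun_prop) (by fun_prop) j)
  · exact abs_mul_le_sq (abs_stepNoise_le hf hs h0 h1 hD hg _ _ _ _)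
      (abs_stepNoise_le hf hs h0 h1 hD hg _ _ _ _)
  · rw [hw i hij, stepNoise_congr hw, stepNoise_congr fun l hl => hw l (hl.trans hij)]
  · rw [integral_const_mul]
    have hfi : Integrable (f (scaledWalk f h s e w j) (e j)) (volume.restrict (Ioo (0 : ℝ) 1)) := by
      refine Integrable.of_bound (hfm.comp (measurable_prodMk_left.comp
        measurable_prodMk_left)).aestronglyMeasurable 1 (Eventually.of_forall fun u => hf _ _ u)
    have hfi' : Integrable (fun u => f (scaledWalk f h s e w j) (e j) u
        - g (scaledWalk f h s e w j) (e j)) (volume.restrict (Ioo (0 : ℝ) 1)) :=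
      hfi.sub (integrable_const _)
    simp only [stepNoise]
    rw [integral_inner hfi', integral_sub hfi (integrable_const _), hfg]
    simp

theorem integral_envNoise_mul_eq_zero [Fintype E] [MeasurableSingletonClass E]
    (hξ : ∀ n, Measurable (ξ n)) (hU : ∀ n, Measurable (U n))
    (hUξ : IndepFun (fun ω n => U n ω) (fun ω n => ξ n ω) Pr) {P : Matrix E E ℝ}
    (hP : ∀ i j, 0 ≤ P i j) (hP1 : ∀ i, ∑ j, P i j = 1) (hM : IsMarkovChain Pr P ξ)
    (hfm : Measurable fun q : Eucl d × E × ℝ => f q.1 q.2.1 q.2.2)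
    (hHm : Measurable fun q : Eucl d × E => H q.1 q.2)
    (hHm' : Measurable fun q : Eucl d × E => H' q.1 q.2) (hDm : ∀ j, Measurable (D j))
    (hf : ∀ y i u, ‖f y i u‖ ≤ 1) (hH : ∀ y i, ‖H y i‖ ≤ B) (hH' : ∀ y i, ‖H' y i‖ ≤ B)
    (hs : s ∈ cube d) (h0 : 0 ≤ h) (h1 : h ≤ 1) (hD : ∀ j, ∀ y ∈ cube d, ‖D j y‖ ≤ R)
    (hHH : ∀ y i, H' y i = ∑ k, P i k • H y k) {i j : ℕ} (hij : i < j) :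
    ∫ ω, envNoise f H H' h s D i (fun n => ξ n ω) (fun n => U n ω) (ξ (i + 1) ω) *
      envNoise f H H' h s D j (fun n => ξ n ω) (fun n => U n ω) (ξ (j + 1) ω) ∂Pr = 0 := by
  -- The earlier noise uses e up to time i + 1 ≤ j, hence it is known before the transition to time
  -- j + 1.
  refine integral_eq_zero_of_markov_indep hξ hU hUξ hP hM (n := j)
    (F := fun e w k => envNoise f H H' h s D i e w (e (i + 1)) * envNoise f H H' h s D j e w k)
    (c := (R * (2 * B)) ^ 2) ?_ (fun e w u => ?_) (fun e e' w u he => ?_) fun e w => ?_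
  · exact (measurable_envNoise hfm hHm hHm' hDm (by fun_prop) (by fun_prop) (by fun_prop) i).mul
      (measurable_envNoise hfm hHm hHm' hDm (by fun_prop) (by fun_prop) (by fun_prop) j)
  · exact abs_mul_le_sq (abs_envNoise_le hf hs h0 h1 hD hH hH' _ _ _ _)
      (abs_envNoise_le hf hs h0 h1 hD hH hH' _ _ _ _)
  · rw [he (i + 1) hij, envNoise_congr he, envNoise_congr fun l hl => he l (hl.trans hij.le)]
  · simp_rw [mul_left_comm (P (e j) _)]
    rw [← Finset.mul_sum]
    simp only [envNoise]
    simp_rw [← real_inner_smul_right]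
    rw [← inner_sum]
    simp_rw [smul_sub]
    rw [Finset.sum_sub_distrib, ← Finset.sum_smul, hP1, one_smul, ← hHH, sub_self, inner_zero_right,
      mul_zero]

end Noise

/-! ### Slowly varying sums -/

/-- Summation by parts: up to a telescoping boundary term, only the increments of v and H remain.
Along the walk these are O(h). -/
lemma abs_sum_inner_sub_le {d : ℕ} {E : Type*} {v : ℕ → Eucl d} {H : ℕ → E → Eucl d} {ξ : ℕ → E}
    {R B α β : ℝ} (hv : ∀ j, ‖v j‖ ≤ R) (hv' : ∀ j, ‖v (j + 1) - v j‖ ≤ α)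
    (hH : ∀ j i, ‖H j i‖ ≤ B) (hH' : ∀ j i, ‖H (j + 1) i - H j i‖ ≤ β) (n : ℕ) :
    |∑ j ∈ Finset.range n, inner ℝ (v j) (H j (ξ j) - H j (ξ (j + 1)))| ≤
      2 * (R * B) + n * (α * B + R * β) := by
  have hR : 0 ≤ R := (norm_nonneg _).trans (hv 0)
  have hα : 0 ≤ α := (norm_nonneg _).trans (hv' 0)
  have hterm (j : ℕ) : inner ℝ (v j) (H j (ξ j) - H j (ξ (j + 1))) =
      -(inner ℝ (v (j + 1)) (H (j + 1) (ξ (j + 1))) - inner ℝ (v j) (H j (ξ j))) +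
      (inner ℝ (v (j + 1) - v j) (H (j + 1) (ξ (j + 1))) +
        inner ℝ (v j) (H (j + 1) (ξ (j + 1)) - H j (ξ (j + 1)))) := by
    simp only [inner_sub_left, inner_sub_right]; ring
  have hc (j : ℕ) : |inner ℝ (v j) (H j (ξ j))| ≤ R * B :=
    (abs_real_inner_le_norm _ _).trans (mul_le_mul (hv j) (hH j _) (norm_nonneg _) hR)
  have herr (j : ℕ) : |inner ℝ (v (j + 1) - v j) (H (j + 1) (ξ (j + 1))) +
      inner ℝ (v j) (H (j + 1) (ξ (j + 1)) - H j (ξ (j + 1)))| ≤ α * B + R * β :=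
    (abs_add_le _ _).trans (add_le_add
      ((abs_real_inner_le_norm _ _).trans (mul_le_mul (hv' j) (hH _ _) (norm_nonneg _) hα))
      ((abs_real_inner_le_norm _ _).trans (mul_le_mul (hv j) (hH' _ _) (norm_nonneg _) hR)))
  rw [Finset.sum_congr rfl fun j _ => hterm j, Finset.sum_add_distrib, Finset.sum_neg_distrib,
    Finset.sum_range_sub fun j => inner ℝ (v j) (H j (ξ j))]
  refine (abs_add_le _ _).trans (add_le_add ?_ ?_)
  · rw [abs_neg]
    exact (abs_sub _ _).trans (by linarith [hc n, hc 0])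
  · refine (Finset.abs_sum_le_sum_abs _ _).trans ((Finset.sum_le_sum fun j _ => herr j).trans ?_)
    rw [Finset.sum_const, Finset.card_range, nsmul_eq_mul]

end ReflectedWalk

namespace ReflectedWalk

/-! ### Convergence of the walk -/

section Convergence

variable {d : ℕ} {E : Type*} {f : Eucl d → E → ℝ → Eucl d} {g H H' : Eucl d → E → Eucl d}
  {b : Eucl d → Eucl d} {x₀ : Eucl d} {C L B Λ : ℝ} {χ k : ℝ → Eucl d}

/-- The constant in front of the step size in the estimate of the distance to the limit. -/
noncomputable def walkConst (d : ℕ) (C L B Λ T : ℝ) : ℝ :=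
  4 * (√d * B) + 2 * T * ((3 + C) * B + √d * (Λ * 3)) + (26 + comparisonConst d L C) * T

/-- A pathwise estimate: all the randomness is in the two hypotheses on the noise sums. -/
lemma IsRegularSolution.norm_scaledWalk_sub_sq_le (hχ : IsRegularSolution b x₀ C χ k)
    (hL0 : 0 ≤ L) (hL : ∀ y z, ‖b y - b z‖ ≤ L * ‖y - z‖) (hf : ∀ y i u, ‖f y i u‖ ≤ 1)
    (hΛ0 : 0 ≤ Λ) (hH : ∀ y i, ‖H y i‖ ≤ B) (hHlip : ∀ y z i, ‖H y i - H z i‖ ≤ Λ * ‖y - z‖)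
    (hP : ∀ y i, H y i - H' y i = g y i - b y) {h : ℝ} (h0 : 0 < h) (h1 : h ≤ 1) {s : Eucl d}
    (hs : s ∈ cube d) {e : ℕ → E} {w : ℕ → ℝ} {N : ℕ} {T η : ℝ} (hN : N * h ≤ T)
    (hS1 : ∀ n ≤ N, h * |∑ j ∈ Finset.range n,
      stepNoise f g h s (fun j y => y - χ (j * h)) j e w (w j)| ≤ η)
    (hS2 : ∀ n ≤ N, h * |∑ j ∈ Finset.range n,
      envNoise f H H' h s (fun j y => y - χ (j * h)) j e w (e (j + 1))| ≤ η) {n : ℕ} (hn : n ≤ N) :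
    ‖scaledWalk f h s e w n - χ (n * h)‖ ^ 2 ≤
      (‖s - x₀‖ ^ 2 + 4 * η + walkConst d C L B Λ T * h) * Real.exp (2 * L * T) := by
  set y : ℕ → Eucl d := scaledWalk f h s e w with hy
  have hyc (j : ℕ) : y j ∈ cube d := scaledWalk_mem_cube hf hs h0.le h1 j
  have hystep (j : ℕ) : ‖y (j + 1) - y j‖ ≤ 3 * h :=
    norm_scaledWalk_succ_sub_le hf hs h0.le h1 j
  have hB0 : 0 ≤ B := (norm_nonneg _).trans (hH 0 (e 0))
  have hC0 := hχ.nonneg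
  have hcc : 0 ≤ comparisonConst d L C := by unfold comparisonConst; positivity
  have hT0 : 0 ≤ T := le_trans (by positivity) hN
  have hη0 : 0 ≤ η := le_trans (by positivity) (hS1 0 (Nat.zero_le _))
  have hW0 : 0 ≤ walkConst d C L B Λ T := by unfold walkConst; positivity
  set v : ℕ → Eucl d := fun j => y j - χ (j * h) with hv
  have hrest (n : ℕ) := abs_sum_inner_sub_le (v := v) (H := fun j => H (y j)) (ξ := e) (R := √d)
    (B := B) (α := (3 + C) * h) (β := Λ * (3 * h))
    (fun j => norm_sub_le_of_mem_cube (hyc j) (hχ.mem_cube _)) (fun j => by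
      have h2 := hχ.lipschitz_x (j * h) ((j + 1 : ℕ) * h) (by push_cast; linarith)
      have h3 : ((j + 1 : ℕ) : ℝ) * h - j * h = h := by push_cast; ring
      rw [h3] at h2
      have e1 : v (j + 1) - v j = (y (j + 1) - y j) - (χ ((j + 1 : ℕ) * h) - χ (j * h)) := by
        simp only [hv]; abel
      rw [e1]
      exact (norm_sub_le _ _).trans (by linarith [hystep j]))
    (fun j i => hH _ _)
    (fun j i => (hHlip _ _ i).trans (mul_le_mul_of_nonneg_left (hystep j) hΛ0)) n
  set r : ℕ → Eucl d := fun j => h • (f (y j) (e j) (w j) - b (y j)) with hr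
  have hdecomp (j : ℕ) : inner ℝ (v j) (f (y j) (e j) (w j) - b (y j)) =
      stepNoise f g h s (fun j y => y - χ (j * h)) j e w (w j) +
      envNoise f H H' h s (fun j y => y - χ (j * h)) j e w (e (j + 1)) +
      inner ℝ (v j) (H (y j) (e j) - H (y j) (e (j + 1))) := by
    simp only [stepNoise, envNoise, ← hy]
    rw [← inner_add_right, ← inner_add_right]
    congr 1
    have := hP (y j) (e j)
    rw [← sub_eq_zero] at this ⊢
    rw [← neg_eq_zero, ← this]
    abel
  -- The push error is 4h² and the squared step is at most 9h², which gives 26 = 2·4 + 2·9 in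
  -- `walkConst`. The term 4η is 2η for each of the two noises.
  have hcomp := hχ.comparison hL0 hL h0.le (N := N) (y := y) (r := r)
    (κ := scaledPush f h s e w) (e := fun _ => 4 * h ^ 2) (q := fun _ => 9 * h ^ 2)
    (A := ‖s - x₀‖ ^ 2 + 4 * η + walkConst d C L B Λ T * h)
    (fun j _ => hyc j) (fun j _ => by
      simp only [hr, scaledPush, ← hy, smul_sub]; abel)
    (fun j _ u hu => inner_scaledPush_ge hf hs h0.le h1 j hu)
    (fun j _ => by
      have := pow_le_pow_left₀ (norm_nonneg _) (hystep j) 2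
      linarith) ?_ hn
  · refine hcomp.trans (mul_le_mul_of_nonneg_left (Real.exp_le_exp.2 ?_) (by positivity))
    have : (n : ℝ) * h ≤ T :=
      le_trans (mul_le_mul_of_nonneg_right (by exact_mod_cast hn) h0.le) hN
    exact mul_le_mul_of_nonneg_left this (by positivity)
  · intro l hl
    have hlT : (l : ℝ) * h ≤ T :=
      le_trans (mul_le_mul_of_nonneg_right (by exact_mod_cast hl) h0.le) hN
    have e1 : ∑ j ∈ Finset.range l, (2 * inner ℝ (y j - χ (j * h)) (r j) + 2 * (4 * h ^ 2)
        + 2 * (9 * h ^ 2) + comparisonConst d L C * h ^ 2) =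
        2 * (h * ∑ j ∈ Finset.range l,
          stepNoise f g h s (fun j y => y - χ (j * h)) j e w (w j)) +
        2 * (h * ∑ j ∈ Finset.range l,
          envNoise f H H' h s (fun j y => y - χ (j * h)) j e w (e (j + 1))) +
        2 * h * ∑ j ∈ Finset.range l, inner ℝ (v j) (H (y j) (e j) - H (y j) (e (j + 1))) +
        (l * h) * (26 + comparisonConst d L C) * h := by
      have e2 (j : ℕ) : 2 * inner ℝ (y j - χ (j * h)) (r j) + 2 * (4 * h ^ 2)
        + 2 * (9 * h ^ 2) + comparisonConst d L C * h ^ 2 =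
          2 * h * (stepNoise f g h s (fun j y => y - χ (j * h)) j e w (w j) +
            envNoise f H H' h s (fun j y => y - χ (j * h)) j e w (e (j + 1)) +
            inner ℝ (v j) (H (y j) (e j) - H (y j) (e (j + 1)))) +
          (26 + comparisonConst d L C) * h ^ 2 := by
        rw [← hdecomp]
        simp only [hr, real_inner_smul_right, hv]
        ring
      simp_rw [e2]
      rw [Finset.sum_add_distrib, ← Finset.mul_sum, Finset.sum_add_distrib,
        Finset.sum_add_distrib, Finset.sum_const, Finset.card_range, nsmul_eq_mul]
      ring
    rw [e1]
    have k1 := (mul_le_mul_of_nonneg_left (le_abs_self _) h0.le).trans (hS1 l hl)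
    have k2 := (mul_le_mul_of_nonneg_left (le_abs_self _) h0.le).trans (hS2 l hl)
    have k3 := mul_le_mul_of_nonneg_left ((le_abs_self _).trans (hrest l))
      (by positivity : 0 ≤ 2 * h)
    have k4 : 2 * h * (2 * (√d * B) + l * ((3 + C) * h * B + √d * (Λ * (3 * h)))) ≤
        (4 * (√d * B) + 2 * T * ((3 + C) * B + √d * (Λ * 3))) * h := by
      have : 0 ≤ (3 + C) * B + √d * (Λ * 3) := by positivity
      have := mul_le_mul_of_nonneg_right hlT this
      have := mul_le_mul_of_nonneg_right this h0.le
      linarith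
    have k5 : (l * h) * (26 + comparisonConst d L C) * h ≤
        ((26 + comparisonConst d L C) * T) * h := by
      rw [mul_comm (26 + comparisonConst d L C) T]
      gcongr
    have k6 : walkConst d C L B Λ T * h =
      (4 * (√d * B) + 2 * T * ((3 + C) * B + √d * (Λ * 3))) * h +
        ((26 + comparisonConst d L C) * T) * h := by rw [walkConst]; ring
    change ‖s - x₀‖ ^ 2 + _ ≤ _
    linarith

lemma IsRegularSolution.norm_rescaledWalk_sub_le (hχ : IsRegularSolution b x₀ C χ k)
    (hf : ∀ y i u, ‖f y i u‖ ≤ 1) {m : ℕ} (hm : 1 ≤ m) {s : Eucl d} (hs : s ∈ cube d)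
    (e : ℕ → E) (w : ℕ → ℝ) {t : ℝ} (ht : 0 ≤ t) :
    ‖rescaledWalk f m ((m : ℝ) • s) e w t - χ t‖ ≤ (3 + C) * (m : ℝ)⁻¹ +
      ‖scaledWalk f (m : ℝ)⁻¹ s e w ⌊(m : ℝ) * t⌋₊ - χ (⌊(m : ℝ) * t⌋₊ * (m : ℝ)⁻¹)‖ := by
  have hm0 : (0 : ℝ) < m := by exact_mod_cast hm
  have h1 : (m : ℝ)⁻¹ ≤ 1 := inv_le_one_of_one_le₀ (by exact_mod_cast hm)
  set n := ⌊(m : ℝ) * t⌋₊ with hn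
  set y := scaledWalk f (m : ℝ)⁻¹ s e w n with hy
  have hyc : y ∈ cube d := scaledWalk_mem_cube hf hs (inv_pos.2 hm0).le h1 n
  have ht1 : (n : ℝ) * (m : ℝ)⁻¹ ≤ t := by
    rw [← div_eq_mul_inv, div_le_iff₀ hm0, mul_comm t]
    exact Nat.floor_le (by positivity)
  have ht2 : t - n * (m : ℝ)⁻¹ ≤ (m : ℝ)⁻¹ := by
    rw [sub_le_iff_le_add, ← one_add_mul, ← div_eq_mul_inv, le_div_iff₀ hm0, mul_comm t, add_comm]
    exact (Nat.lt_floor_add_one _).le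
  have e1 : rescaledWalk f m ((m : ℝ) • s) e w t =
      fold 1 (y + (t - n * (m : ℝ)⁻¹) • f y (e n) (w n)) := by
    rw [rescaledWalk, walk_eq_smul_scaledWalk hm, inv_smul_smul₀ hm0.ne', div_eq_mul_inv]
  have h2 : ‖rescaledWalk f m ((m : ℝ) • s) e w t - y‖ ≤ 3 * (m : ℝ)⁻¹ := by
    rw [e1]
    refine (norm_fold_sub_le hyc).trans (mul_le_mul_of_nonneg_left ?_ (by norm_num))
    rw [add_sub_cancel_left]
    exact (norm_smul_step_le hf (sub_nonneg.2 ht1) _ _ _).trans ht2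
  have h3 := hχ.lipschitz_x _ _ ht1
  have h4 := mul_le_mul_of_nonneg_left ht2 hχ.nonneg
  have e2 : rescaledWalk f m ((m : ℝ) • s) e w t - χ t =
      (rescaledWalk f m ((m : ℝ) • s) e w t - y) + (y - χ (n * (m : ℝ)⁻¹))
        - (χ t - χ (n * (m : ℝ)⁻¹)) := by abel
  rw [e2]
  refine (norm_sub_le _ _).trans ((add_le_add_left (norm_add_le _ _) _).trans ?_)
  linarith

theorem IsRegularSolution.tendsto_measure_le_supDist [Fintype E] [MeasurableSpace E]
    [MeasurableSingletonClass E] {Ω : Type*} [MeasurableSpace Ω] {Pr : Measure Ω}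
    [IsProbabilityMeasure Pr] (hχ : IsRegularSolution b x₀ C χ k)
    (hL0 : 0 ≤ L) (hL : ∀ y z, ‖b y - b z‖ ≤ L * ‖y - z‖) (hf : ∀ y i u, ‖f y i u‖ ≤ 1)
    (hfm : Measurable fun q : Eucl d × E × ℝ => f q.1 q.2.1 q.2.2)
    (hgm : Measurable fun q : Eucl d × E => g q.1 q.2) (hg : ∀ y i, ‖g y i‖ ≤ 1)
    (hfg : ∀ y i, ∫ u in Ioo (0 : ℝ) 1, f y i u = g y i)
    (hΛ0 : 0 ≤ Λ) (hH : ∀ y i, ‖H y i‖ ≤ B) (hHlip : ∀ y z i, ‖H y i - H z i‖ ≤ Λ * ‖y - z‖)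
    (hH' : ∀ y i, ‖H' y i‖ ≤ B) (hHm : Measurable fun q : Eucl d × E => H q.1 q.2)
    (hHm' : Measurable fun q : Eucl d × E => H' q.1 q.2)
    {P : Matrix E E ℝ} (hP0 : ∀ i j, 0 ≤ P i j) (hP1 : ∀ i, ∑ j, P i j = 1)
    (hHH : ∀ y i, H' y i = ∑ k, P i k • H y k) (hP : ∀ y i, H y i - H' y i = g y i - b y)
    {ξ : ℕ → Ω → E} (hξ : ∀ n, Measurable (ξ n)) (hM : IsMarkovChain Pr P ξ)
    {U : ℕ → Ω → ℝ} (hU : ∀ n, Measurable (U n))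
    (hlaw : ∀ n, Pr.map (U n) = volume.restrict (Ioo (0 : ℝ) 1)) (hind : iIndepFun U Pr)
    (hUξ : IndepFun (fun ω n => U n ω) (fun ω n => ξ n ω) Pr)
    {s : ℕ → Eucl d} (hs : ∀ m : ℕ, 1 ≤ m → s m ∈ cube d) (hsx : Tendsto s atTop (𝓝 x₀))
    {T : ℝ} (hT : 0 < T) {ε : ℝ≥0∞} (hε : 0 < ε) :
    Tendsto (fun m : ℕ => Pr {ω | ε ≤ supDist T (rescaledWalk f m ((m : ℝ) • s m)
      (fun n => ξ n ω) (fun n => U n ω)) χ}) atTop (𝓝 0) := by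
  obtain ⟨ρ, hρ0, hρε⟩ : ∃ ρ : ℝ, 0 < ρ ∧ ENNReal.ofReal (3 * ρ) < ε := by
    obtain ⟨a, ha0, haε⟩ := ENNReal.lt_iff_exists_nnreal_btwn.1 hε
    have ha : 0 < (a : ℝ) := by exact_mod_cast ha0
    refine ⟨a / 3, by positivity, ?_⟩
    rw [mul_div_cancel₀ _ (by norm_num : (3 : ℝ) ≠ 0), ENNReal.ofReal_coe_nnreal]
    exact haε
  set ex := Real.exp (2 * L * T) with hex
  have hex0 : 0 < ex := Real.exp_pos _
  -- Makes 4η times the Gronwall factor equal to ρ²/2, leaving room for the terms that vanish as m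
  -- grows.
  set η : ℝ := ρ ^ 2 / (8 * ex) with hη
  have hη0 : 0 < η := by positivity
  set D : ℕ → ℕ → Eucl d → Eucl d := fun m j y => y - χ (j * (m : ℝ)⁻¹) with hDdef
  have hDm (m j : ℕ) : Measurable (D m j) := measurable_id.sub_const _
  have hD (m j : ℕ) (y : Eucl d) (hy : y ∈ cube d) : ‖D m j y‖ ≤ √d :=
    norm_sub_le_of_mem_cube hy (hχ.mem_cube _)
  have hinv0 (m : ℕ) : 0 ≤ (m : ℝ)⁻¹ := by positivity
  have hinv1 (m : ℕ) (hm : 1 ≤ m) : (m : ℝ)⁻¹ ≤ 1 := inv_le_one_of_one_le₀ (by exact_mod_cast hm)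
  have hξp : Measurable fun ω n => ξ n ω := measurable_path hξ
  have hUp : Measurable fun ω n => U n ω := measurable_path hU
  have lim1 := tendsto_measure_exists_le_abs_sum (Pr := Pr) (c := √d * (2 * 1))
    (ζ := fun m j ω => stepNoise f g (m : ℝ)⁻¹ (s m) (D m) j (fun n => ξ n ω) (fun n => U n ω)
      (U j ω))
    (fun m _ j => measurable_stepNoise hfm hgm (hDm m) hξp hUp (hU j) j)
    (fun m hm j ω => abs_stepNoise_le hf (hs m hm) (hinv0 m) (hinv1 m hm) (hD m) hg _ _ _ _)
    (fun m hm i j hij => integral_stepNoise_mul_eq_zero hξ hU hlaw hind hUξ hfm hgm (hDm m) hf hg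
      (hs m hm) (hinv0 m) (hinv1 m hm) (hD m) hfg hij) hT hη0
  have lim2 := tendsto_measure_exists_le_abs_sum (Pr := Pr) (c := √d * (2 * B))
    (ζ := fun m j ω => envNoise f H H' (m : ℝ)⁻¹ (s m) (D m) j (fun n => ξ n ω) (fun n => U n ω)
      (ξ (j + 1) ω))
    (fun m _ j => measurable_envNoise hfm hHm hHm' (hDm m) hξp hUp (hξ _) j)
    (fun m hm j ω => abs_envNoise_le hf (hs m hm) (hinv0 m) (hinv1 m hm) (hD m) hH hH' _ _ _ _)
    (fun m hm i j hij => integral_envNoise_mul_eq_zero hξ hU hUξ hP0 hP1 hM hfm hHm hHm' (hDm m) hf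
      hH hH' (hs m hm) (hinv0 m) (hinv1 m hm) (hD m) hHH hij) hT hη0
  have hinv : Tendsto (fun m : ℕ => (m : ℝ)⁻¹) atTop (𝓝 0) := tendsto_inv_atTop_nhds_zero_nat
  have hA : Tendsto (fun m : ℕ => (‖s m - x₀‖ ^ 2 + 4 * η + walkConst d C L B Λ T * (m : ℝ)⁻¹) * ex)
      atTop (𝓝 (4 * η * ex)) := by
    have h1 : Tendsto (fun m => ‖s m - x₀‖ ^ 2) atTop (𝓝 0) := by
      simpa using ((hsx.sub_const x₀).norm).pow 2
    simpa using ((h1.add_const (4 * η)).add (hinv.const_mul (walkConst d C L B Λ T))).mul_const ex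
  have hAρ : 4 * η * ex < ρ ^ 2 := by
    have : 4 * η * ex = ρ ^ 2 / 2 := by rw [hη]; field_simp; ring
    rw [this]; linarith [pow_pos hρ0 2]
  have hC : Tendsto (fun m : ℕ => (3 + C) * (m : ℝ)⁻¹) atTop (𝓝 0) := by
    simpa using hinv.const_mul (3 + C)
  refine tendsto_of_tendsto_of_tendsto_of_le_of_le' tendsto_const_nhds
    (by simpa using lim1.add lim2) (Eventually.of_forall fun _ => zero_le) ?_
  filter_upwards [hA.eventually_lt_const hAρ, hC.eventually_lt_const hρ0, eventually_ge_atTop 1]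
    with m hm1 hm2 hm
  -- Outside the two noise events, the interpolation error and the error at grid times are each
  -- below ρ. Only an inclusion of events is needed, so the measurability of the supremum plays no
  -- role.
  refine (measure_mono ?_).trans (measure_union_le _ _)
  have hm0 : (0 : ℝ) < m := by exact_mod_cast hm
  intro ω hω
  by_contra hnot
  rw [mem_union, not_or] at hnot
  have hsmall {a : ℝ} (ha : ¬ η * m ≤ a) : (m : ℝ)⁻¹ * a ≤ η := by
    rw [inv_mul_le_iff₀ hm0, mul_comm]; exact (not_le.1 ha).le
  have hNle (n : ℕ) (hn : n ≤ ⌊(m : ℝ) * T⌋₊) : (n : ℝ) ≤ m * T :=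
    (Nat.cast_le.2 hn).trans (Nat.floor_le (by positivity))
  have hkey {n : ℕ} (hn : n ≤ ⌊(m : ℝ) * T⌋₊) := hχ.norm_scaledWalk_sub_sq_le hL0 hL hf hΛ0 hH
    hHlip hP (inv_pos.2 hm0) (hinv1 m hm) (hs m hm) (e := fun n => ξ n ω) (w := fun n => U n ω)
    (N := ⌊(m : ℝ) * T⌋₊) (T := T) (η := η)
    (by rw [← div_eq_mul_inv, div_le_iff₀ hm0, mul_comm T]; exact hNle _ le_rfl)
    (fun n hn => hsmall fun h => hnot.1 ⟨n, hNle n hn, h⟩)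
    (fun n hn => hsmall fun h => hnot.2 ⟨n, hNle n hn, h⟩) hn
  have hle : supDist T (rescaledWalk f m ((m : ℝ) • s m) (fun n => ξ n ω) (fun n => U n ω)) χ ≤
      ENNReal.ofReal (3 * ρ) := by
    refine iSup₂_le fun t ht => ?_
    rw [edist_dist, dist_eq_norm]
    refine ENNReal.ofReal_le_ofReal ?_
    refine (hχ.norm_rescaledWalk_sub_le hf hm (hs m hm) _ _ ht.1).trans ?_
    have h1 := hkey (n := ⌊(m : ℝ) * t⌋₊)
      (Nat.floor_mono (mul_le_mul_of_nonneg_left ht.2 hm0.le))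
    have h2 := lt_of_pow_lt_pow_left₀ 2 hρ0.le (h1.trans_lt hm1)
    linarith
  exact (hω.trans hle).not_gt hρε

end Convergence

end ReflectedWalk

/-! ### The main theorem -/

open ReflectedWalk in
theorem mainTheorem10 {d : ℕ} {E : Type*} [Fintype E] [DecidableEq E]
    [MeasurableSpace E] [MeasurableSingletonClass E]
    {Ω : Type*} [MeasurableSpace Ω] (Pr : Measure Ω) [IsProbabilityMeasure Pr]
    -- the step probabilities
    (p : ReflectedWalk.Eucl d → E → ReflectedWalk.StepLabel d → ℝ)
    (hp_sum : ∀ x i, ∑ v, p x i v = 1)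
    (hA1 : ∃ K : ℝ, ∀ x y i v, |p x i v - p y i v| ≤ K * ‖x - y‖)
    (hA2 : ∀ x i v, 0 < p x i v)
    -- the environment
    (P : Matrix E E ℝ) (hP : P ∈ Matrix.rowStochastic ℝ E)
    (hA3 : P.IsIrreducible)
    (μ : E → ℝ) (hμ : ReflectedWalk.IsInvariantProb P μ)
    (ξ : ℕ → Ω → E) (hξ_meas : ∀ n, Measurable (ξ n))
    (hξ : ReflectedWalk.IsMarkovChain Pr P ξ)
    -- the uniform variables
    (U : ℕ → Ω → ℝ) (hU_meas : ∀ n, Measurable (U n))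
    (hU_law : ∀ n, Pr.map (U n) = volume.restrict (Set.Ioo (0 : ℝ) 1))
    (hU_indep : iIndepFun U Pr)
    (hUξ : IndepFun (fun ω n => U n ω) (fun ω n => ξ n ω) Pr)
    -- the order on the set of steps used for the inverse cumulative distribution function
    (ord : Fin (2 * d) ≃ ReflectedWalk.StepLabel d)
    -- the starting points
    (x : ReflectedWalk.Eucl d) (xm : ℕ → ReflectedWalk.Eucl d)
    (hxm_cube : ∀ m : ℕ, 1 ≤ m → xm m ∈ ReflectedWalk.cube d)
    (hxm_int : ∀ m : ℕ, 1 ≤ m → ∀ l, ∃ z : ℤ, (m : ℝ) * xm m l = z)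
    (hxm : Tendsto xm atTop (𝓝 x)) :
    ∃ χ : ℝ → ReflectedWalk.Eucl d,
      ReflectedWalk.IsReflectedSolution (ReflectedWalk.avgDrift p μ) x χ ∧
      (∀ χ' : ℝ → ReflectedWalk.Eucl d,
        ReflectedWalk.IsReflectedSolution (ReflectedWalk.avgDrift p μ) x χ' →
          Set.EqOn χ' χ (Set.Ici 0)) ∧
      ∀ T : ℝ, 0 < T → ∀ ε : ℝ≥0∞, 0 < ε →
        Tendsto
          (fun m : ℕ => Pr {ω | ε ≤ ReflectedWalk.supDist T
            (ReflectedWalk.rescaledWalk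
              (fun y i u => ReflectedWalk.invCdf ord (p y i) u) m ((m : ℝ) • xm m)
              (fun n => ξ n ω) (fun n => U n ω)) χ})
          atTop (𝓝 0) := by
  obtain ⟨K, hK⟩ := hA1
  have hK' : ∀ x y i v, |p x i v - p y i v| ≤ |K| * ‖x - y‖ := fun x y i v =>
    (hK x y i v).trans (mul_le_mul_of_nonneg_right (le_abs_self K) (norm_nonneg _))
  have hp0 : ∀ x i v, 0 ≤ p x i v := fun x i v => (hA2 x i v).le
  have hP0 : ∀ i j, 0 ≤ P i j := fun i j => Matrix.nonneg_of_mem_rowStochastic hP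
  have hP1 : ∀ i, ∑ j, P i j = 1 := Matrix.sum_row_of_mem_rowStochastic hP
  set L : ℝ := 2 * d * |K|
  have hL0 : 0 ≤ L := by positivity
  have hg : ∀ y i, ‖stepDrift p y i‖ ≤ 1 := norm_stepDrift_le hp0 hp_sum
  have hglip : ∀ y z i, ‖stepDrift p y i - stepDrift p z i‖ ≤ L * ‖y - z‖ :=
    norm_stepDrift_sub_le hK'
  have hb : ∀ y, ‖avgDrift p μ y‖ ≤ 1 := fun y => by
    rw [avgDrift_eq_sum]
    simpa [hμ.sum_abs] using norm_sum_smul_le (c := μ) (hg y)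
  have hblip : ∀ y z, ‖avgDrift p μ y - avgDrift p μ z‖ ≤ L * ‖y - z‖ := fun y z => by
    rw [avgDrift_eq_sum, avgDrift_eq_sum, ← Finset.sum_sub_distrib]
    simp_rw [← smul_sub]
    simpa [hμ.sum_abs] using norm_sum_smul_le (c := μ) (hglip y z)
  have hx : x ∈ cube d := isClosed_cube.mem_of_tendsto hxm
    (by filter_upwards [eventually_ge_atTop 1] with m hm using hxm_cube m hm)
  obtain ⟨C, χ, k, hχ⟩ := exists_isRegularSolution hL0 hblip zero_le_one (fun y _ => hb y) hx
  obtain ⟨G, hG⟩ := exists_poisson_kernel hP hA3 hμ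
  set B : ℝ := ∑ i, ∑ k, |G i k|
  have hGB (i : E) : ∑ k, |G i k| ≤ B :=
    Finset.single_le_sum (f := fun i => ∑ k, |G i k|)
      (fun i _ => Finset.sum_nonneg fun k _ => abs_nonneg _) (Finset.mem_univ i)
  have hB0 : 0 ≤ B := Finset.sum_nonneg fun i _ => Finset.sum_nonneg fun k _ => abs_nonneg _
  -- The kernel G does not depend on y, so this solution of the Poisson equation inherits
  -- boundedness and the Lipschitz property in y from the mean step.
  set H : Eucl d → E → Eucl d := fun y i => ∑ k, G i k • stepDrift p y k with hHdef
  set H' : Eucl d → E → Eucl d := fun y i => ∑ k, P i k • H y k with hHdef'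
  have hH : ∀ y i, ‖H y i‖ ≤ B := fun y i =>
    (norm_sum_smul_le (hg y)).trans (by simpa using hGB i)
  have hHlip : ∀ y z i, ‖H y i - H z i‖ ≤ B * L * ‖y - z‖ := fun y z i => by
    simp only [hHdef]
    rw [← Finset.sum_sub_distrib, mul_assoc]
    simp_rw [← smul_sub]
    exact (norm_sum_smul_le (hglip y z)).trans
      (mul_le_mul_of_nonneg_right (hGB i) (by positivity))
  have hPabs (i : E) : ∑ k, |P i k| = 1 := by
    rw [← hP1 i]; exact Finset.sum_congr rfl fun k _ => abs_of_nonneg (hP0 i k)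
  have hH' : ∀ y i, ‖H' y i‖ ≤ B := fun y i => by
    simpa [hPabs] using norm_sum_smul_le (c := P i) (hH y)
  have hHH : ∀ y i, H y i - H' y i = stepDrift p y i - avgDrift p μ y := fun y i => by
    have e1 : H' y i = ∑ k, (∑ l, P i l * G l k) • stepDrift p y k := by
      simp only [hHdef', hHdef, Finset.smul_sum, smul_smul, Finset.sum_smul]
      exact Finset.sum_comm
    rw [e1, avgDrift_eq_sum]
    simp only [hHdef]
    rw [← Finset.sum_sub_distrib]
    simp_rw [← sub_smul, hG, sub_smul, Finset.sum_sub_distrib]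
    simp
  have hcont {Q : Eucl d → E → Eucl d} {c : ℝ} (hc : 0 ≤ c)
      (hQ : ∀ y z i, ‖Q y i - Q z i‖ ≤ c * ‖y - z‖) : Measurable fun q : Eucl d × E => Q q.1 q.2 :=
    measurable_from_prod_countable_left fun i =>
      (continuous_of_norm_sub_le (b := fun y => Q y i) hc fun y z => hQ y z i).measurable
  have hHm := hcont (by positivity) hHlip
  have hHm' : Measurable fun q : Eucl d × E => H' q.1 q.2 :=
    measurable_from_prod_countable_left fun i => Finset.measurable_sum _ fun k _ =>
      (hHm.comp (measurable_prodMk_right (y := k))).const_smul (P i k)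
  have hpm (v : StepLabel d) : Measurable fun q : Eucl d × E => p q.1 q.2 v :=
    measurable_from_prod_countable_left fun i => by
      refine (LipschitzWith.of_dist_le_mul (K := ⟨|K|, abs_nonneg K⟩) fun y z => ?_ :
        LipschitzWith _ fun y => p y i v).continuous.measurable
      rw [Real.dist_eq, dist_eq_norm]
      exact hK' y z i v
  have hfm : Measurable fun q : Eucl d × E × ℝ => invCdf ord (p q.1 q.2.1) q.2.2 :=
    measurable_invCdf ord (fun v => (hpm v).comp (measurable_fst.prodMk
      (measurable_fst.comp measurable_snd))) (measurable_snd.comp measurable_snd)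
  refine ⟨χ, hχ.isReflectedSolution, fun χ' hχ' t ht => ?_, fun T hT ε hε => ?_⟩
  · rcases (mem_Ici.1 ht).eq_or_lt with h0 | h0
    · rw [← h0, hχ.isReflectedSolution.apply_zero, hχ'.apply_zero]
    · exact hχ.eq_of_isReflectedSolution hL0 hblip zero_le_one (fun y _ => hb y) hχ' h0
  · exact hχ.tendsto_measure_le_supDist (f := fun y i u => invCdf ord (p y i) u) hL0 hblip
      (fun _ _ _ => norm_invCdf_le _ _ _) hfm (hcont hL0 hglip) hg
      (fun y i => integral_invCdf ord (hp0 y i) (hp_sum y i)) (by positivity) hH hHlip hH' hHm hHm'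
      hP0 hP1 (fun _ _ => rfl) hHH hξ_meas hξ hU_meas hU_law hU_indep hUξ hxm_cube hxm hT hε
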